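/- **Corollary (Emergence of complete aggregation).** Let $\langle w,z\rangle=\sum_{i=1}^d\overline{w^i}z^i$ and $\|\cdot\|$ be the standard Hermitian inner product and norm on $\mathbb C^d$, $v\cdot w=\mathrm{Re}\langle v,w\rangle$, and $\mathbb{HS}^{d-1}=\{z\in\mathbb C^d:\|z\|=1\}$. Let $\kappa_0,\kappa_1\in\mathbb R$ and let $\Omega\in\mathbb C^{d\times d}$ be skew-Hermitian ($\Omega^\dagger=-\Omega$), the common natural frequency matrix. For a probability measure $\mu$ on $\mathbb{HS}^{d-1}$ put $$L[\mu](z)=\Omega z+\int_{\mathbb{HS}^{d-1}}\big[\kappa_0(z_*-\langle z_*,z\rangle z)+\kappa_1(\langle z,z_*\rangle z-\langle z_*,z\rangle z)\big]\,d\mu(z_*).$$ A measure-valued solution of the kinetic Lohe Hermitian sphere model $\partial_t\rho+\nabla_z\cdot(L[\rho]\rho)=0$ with initial measure $\mu_0$ is a weakly continuous family $(\mu_t)_{t\ge0}$ of Borel probability measures on $\mathbb{HS}^{d-1}$ that starts at $\mu_0$ and satisfies, for all $t\ge0$ and all $\phi\in C^1_c([0,\infty)\times\mathbb{HS}^{d-1})$,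 $$\int\phi(t,\cdot)\,d\mu_t-\int\phi(0,\cdot)\,d\mu_0=\int_0^t\!\int\big(\partial_s\phi+L[\mu_s]\cdot\nabla_z\phi\big)\,d\mu_s\,ds,$$ where $\nabla_z$ is the covariant derivative on $\mathbb{HS}^{d-1}$. (This includes solutions given by a density, $\mu_t=\rho(t,\cdot)\,d\sigma$ with $\sigma$ the surface measure, and the case $\Omega=0$.) Let $W_2$ be the Wasserstein distance of order $2$ with respect to $\|\cdot\|$. Suppose that $|\kappa_1|<\kappa_0/2$ and that, for some $\delta>0$, $$\sup_{z,w\in\mathrm{supp}(\mu_0)}|1-\langle z,w\rangle|<1-\frac{2|\kappa_1|}{\kappa_0}-\delta,$$ and let $(\mu_t)_{t\ge0}$ be a measure-valued solution with initial measure $\mu_0$. Then there is a continuous curve $z:[0,\infty)\to\mathbb{HS}^{d-1}$ such that $$\lim_{t\to\infty}W_2(\mu_t,\delta_{z(t)})=0.$$ In particular a bi-polar state cannot emerge: for every $m\in(0,1)$ and every map $w:[0,\infty)\to\mathbb{HS}^{d-1}$, $W_2\big(\mu_t,\,m\delta_{w(t)}+(1-m)\delta_{-w(t)}\big)$ does not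 tend to $0$ as $t\to\infty$. -/

import Mathlib

open MeasureTheory Set Filter Topology
open scoped ENNReal Matrix

noncomputable section

namespace LHS

/-- The complex Euclidean space `ℂ^d`, with `inner ℂ w z = ∑ i, conj (w i) * z i`. -/
abbrev Cd (d : ℕ) : Type := EuclideanSpace ℂ (Fin d)

/-- The Hermitian sphere `{z ∈ ℂ^d | ‖z‖ = 1}`. -/
abbrev HS (d : ℕ) : Type := Metric.sphere (0 : Cd d) 1

/-- The real dot product `z · w = ∑ i, (Re z i * Re w i + Im z i * Im w i)` on `ℂ^d = ℝ^{2d}`. -/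
def dot {d : ℕ} (z w : Cd d) : ℝ :=
  ∑ i, ((z i).re * (w i).re + (z i).im * (w i).im)

/-- Mathlib's real inner product on `ℂ^d` (the one used by `gradient`) is the real dot product. -/
theorem inner_real_eq_dot {d : ℕ} (z w : Cd d) : inner ℝ z w = dot z w := by
  simp [dot, PiLp.inner_apply, Complex.inner, mul_comm]

/-- The covariant derivative on the sphere of a function `f` that is differentiable near the
sphere: the orthogonal projection of the Euclidean gradient to the tangent space at `z`. -/
def covGrad {d : ℕ} (f : Cd d → ℝ) (z : Cd d) : Cd d :=
  gradient f z - dot (gradient f z) z • z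

/-- On tangent vectors the covariant derivative computes the directional derivative. -/
theorem dot_covGrad {d : ℕ} (f : Cd d → ℝ) (z v : Cd d) (hv : dot v z = 0) :
    dot v (covGrad f z) = fderiv ℝ f z v := by
  rw [← inner_real_eq_dot] at hv ⊢
  rw [covGrad, inner_sub_right, inner_smul_right, hv, mul_zero, sub_zero, real_inner_comm,
    gradient, InnerProductSpace.toDual_symm_apply]

/-- The velocity field
`L[μ](z) = Ω z + ∫ [κ₀ (y - ⟨y, z⟩ z) + κ₁ (⟨z, y⟩ z - ⟨y, z⟩ z)] dμ(y)`. -/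
def velocity {d : ℕ} (κ₀ κ₁ : ℝ) (Ω : Matrix (Fin d) (Fin d) ℂ) (μ : Measure (HS d)) (z : Cd d) :
    Cd d :=
  Matrix.toEuclideanLin Ω z +
    ∫ y : HS d,
      ((κ₀ : ℂ) • ((y : Cd d) - inner ℂ (y : Cd d) z • z) +
        (κ₁ : ℂ) • (inner ℂ z (y : Cd d) • z - inner ℂ (y : Cd d) z • z)) ∂μ

/-- Test functions in `C¹_c([0, ∞) × HS)`, given by a `C¹` extension to `ℝ × ℂ^d`; the support in
`[0, ∞) × HS` is compact exactly when the function vanishes there for all large times. -/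
structure IsTestFunction {d : ℕ} (φ : ℝ × Cd d → ℝ) : Prop where
  contDiff : ContDiff ℝ 1 φ
  vanishes : ∃ T : ℝ, ∀ t : ℝ, T ≤ t → ∀ z : HS d, φ (t, z) = 0

/-- `μ` is a measure-valued solution on `[0, ∞)`, with initial measure `μ₀`, of
`∂ₜ ρ + ∇_z · (L[ρ] ρ) = 0` on the Hermitian sphere, where all natural frequency matrices are `Ω`.
The values of `μ` at negative times play no role. -/
structure IsMeasureValuedSolution {d : ℕ} (κ₀ κ₁ : ℝ) (Ω : Matrix (Fin d) (Fin d) ℂ)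
    (μ₀ : ProbabilityMeasure (HS d)) (μ : ℝ → ProbabilityMeasure (HS d)) : Prop where
  initial : μ 0 = μ₀
  /-- Weak continuity: the topology on `ProbabilityMeasure` is that of weak convergence. -/
  continuousOn : ContinuousOn μ (Ici 0)
  weak : ∀ φ : ℝ × Cd d → ℝ, IsTestFunction φ → ∀ t : ℝ, 0 ≤ t →
    (∫ z : HS d, φ (t, z) ∂(μ t : Measure (HS d))) -
        (∫ z : HS d, φ (0, z) ∂(μ₀ : Measure (HS d))) =
      ∫ s in (0 : ℝ)..t, ∫ z : HS d,
        (deriv (fun τ => φ (τ, z)) s +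
          dot (velocity κ₀ κ₁ Ω (μ s : Measure (HS d)) z) (covGrad (fun x => φ (s, x)) z))
          ∂(μ s : Measure (HS d))

/-- The transport plans between `μ` and `ν`. -/
def transportPlans {X : Type*} [MeasurableSpace X] (μ ν : Measure X) : Set (Measure (X × X)) :=
  {γ | γ.map Prod.fst = μ ∧ γ.map Prod.snd = ν}

/-- The Wasserstein distance of order `p`. On `HS d` the distance is `‖y - y'‖`. -/
def wasserstein {X : Type*} [MeasurableSpace X] [PseudoEMetricSpace X] (p : ℝ) (μ ν : Measure X) :
    ℝ≥0∞ :=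
  (⨅ γ ∈ transportPlans μ ν, ∫⁻ y, edist y.1 y.2 ^ p ∂γ) ^ (1 / p)

/-- The bi-polar measure `m δ_w + (1 - m) δ_{-w}`. -/
def bipolar {d : ℕ} (m : ℝ) (w : HS d) : Measure (HS d) :=
  ENNReal.ofReal m • Measure.dirac w + ENNReal.ofReal (1 - m) • Measure.dirac (-w)

end LHS

end

/-!
All gaps `|1 - ⟨z, w⟩|` between points of the support stay below their initial bound `a`, their mean
square then decays exponentially, and this forces the mean `m_t = ∫ z dμ_t` to approach the sphere.
No characteristic flow is used: everything is read off from the weak formulation.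

Only the mean of `μ_t` enters the velocity (`velocity_eq_field`). For an observable `f` the weak
formulation says that `∫ f dμ_t` is differentiable with the expected derivative
(`IsMeasureValuedSolution.hasDerivAt_integral`). For a symmetric kernel `φ(z, w)` the function
`(s, r) ↦ ∬ φ dμ_s dμ_r` therefore has continuous partial derivatives, and the chain rule along the
diagonal gives the evolution of interaction energies
(`IsMeasureValuedSolution.hasDerivAt_integral_integral`).

When `z` and `w` both move, `Ω` drops out of the derivative of `⟨z, w⟩`. The attraction `κ₀`
decreases `|1 - ⟨z, w⟩|²` at the rate `2κ₀ (Re⟨m, z⟩ + Re⟨m, w⟩)`, and `κ₁` contributes at most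
`4|κ₁| |1 - ⟨z, w⟩| (|Im⟨m, z⟩| + |Im⟨m, w⟩|)` (`gapSqDeriv_add_le`). Both brackets are controlled by
the average gaps of `z` and `w` to the third point over which `m` averages.

* For `φ = (|1 - ⟨z, w⟩|² - a²)₊²` with `2|κ₁| ≤ κ₀ (1 - a)` a positive contribution to the derivative
  can only come from third points whose gap exceeds `a`, so the energy `E` satisfies `E' ≤ C E` and
  remains zero (`IsMeasureValuedSolution.integral_excess_eq_zero`).
* For `φ = |1 - ⟨z, w⟩|²` this gives `E' ≤ -4 (κ₀ (1 - a) - 2|κ₁|) E`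
  (`IsMeasureValuedSolution.integral_gap_sq_le`).

Since `|1 - ‖m_t‖²|` is at most the mean gap, `m_t` never vanishes and `‖m_t‖ → 1`
(`IsMeasureValuedSolution.norm_mean`). Now `W₂(μ_t, δ_z)² ≤ 2 - 2‖m_t‖` for the direction `z` of
`m_t` (`wasserstein_dirac_le`). The mean is `1`-Lipschitz for `W₂`, and that of a bi-polar state has
norm `|2m - 1| < 1`, so bi-polar states stay away from `μ_t`.
-/

namespace LHS

open scoped ComplexConjugate

/-! ### Weakly continuous integrals over a compact space -/

section Compact

variable {K : Type*} [TopologicalSpace K] [CompactSpace K] [MeasurableSpace K]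
  [OpensMeasurableSpace K]

theorem integrable_of_continuous (π : Measure K) [IsFiniteMeasure π] {f : K → ℝ}
    (hf : Continuous f) : Integrable f π :=
  hf.integrable_of_hasCompactSupport (HasCompactSupport.of_compactSpace f)

/-- Integration of a continuous function of a parameter and of a point of a compact space is
jointly continuous in the parameter and in the probability measure. -/
theorem continuous_integral_param {X : Type*} [TopologicalSpace X] {G : X → K → ℝ}
    (hG : Continuous fun p : X × K => G p.1 p.2) :
    Continuous fun p : X × ProbabilityMeasure K => ∫ z, G p.1 z ∂(p.2 : Measure K) := by
  have hGx : ∀ x, Continuous (G x) := fun x => hG.comp (by fun_prop : Continuous fun z => (x, z))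
  let g : C(X, C(K, ℝ)) := ContinuousMap.curry ⟨fun p : X × K => G p.1 p.2, hG⟩
  rw [continuous_iff_continuousAt]
  rintro ⟨x₀, π₀⟩
  have h1 : Tendsto (fun p : X × ProbabilityMeasure K => ∫ z, G x₀ z ∂(p.2 : Measure K))
      (𝓝 (x₀, π₀)) (𝓝 (∫ z, G x₀ z ∂(π₀ : Measure K))) :=
    ((ProbabilityMeasure.continuous_integral_boundedContinuousFunction
      (BoundedContinuousFunction.mkOfCompact ⟨G x₀, hGx x₀⟩)).comp
        continuous_snd).tendsto (x₀, π₀)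
  have h2 : Tendsto (fun p : X × ProbabilityMeasure K =>
      ∫ z, G p.1 z ∂(p.2 : Measure K) - ∫ z, G x₀ z ∂(p.2 : Measure K))
      (𝓝 (x₀, π₀)) (𝓝 0) := by
    have h3 : Tendsto (fun p : X × ProbabilityMeasure K => dist (g p.1) (g x₀))
        (𝓝 (x₀, π₀)) (𝓝 0) := by
      have : Continuous fun p : X × ProbabilityMeasure K => dist (g p.1) (g x₀) := by fun_prop
      simpa using this.tendsto (x₀, π₀)
    refine squeeze_zero_norm (fun p => ?_) h3
    rw [← integral_sub (integrable_of_continuous _ (hGx _)) (integrable_of_continuous _ (hGx _))]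
    refine (norm_integral_le_of_norm_le_const (C := dist (g p.1) (g x₀))
      (ae_of_all _ fun z => ?_)).trans (by simp)
    exact ContinuousMap.dist_apply_le_dist (f := g p.1) (g := g x₀) z
  simpa [ContinuousAt] using h2.add h1

theorem continuous_integral_comp {X : Type*} [TopologicalSpace X] {G : X → K → ℝ}
    (hG : Continuous fun p : X × K => G p.1 p.2) {ν : X → ProbabilityMeasure K}
    (hν : Continuous ν) : Continuous fun x => ∫ z, G x z ∂(ν x : Measure K) :=
  (continuous_integral_param hG).comp (continuous_id.prodMk hν)

theorem continuous_integral_of_continuous (π : Measure K) [IsProbabilityMeasure π]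
    {X : Type*} [TopologicalSpace X] {G : X → K → ℝ}
    (hG : Continuous fun p : X × K => G p.1 p.2) : Continuous fun x => ∫ z, G x z ∂π := by
  let P : ProbabilityMeasure K := ⟨π, inferInstance⟩
  exact continuous_integral_comp hG (continuous_const (y := P))

theorem integral_swap_of_continuous [SecondCountableTopology K] (π ρ : Measure K)
    [IsFiniteMeasure π] [IsFiniteMeasure ρ] {f : K → K → ℝ}
    (hf : Continuous fun p : K × K => f p.1 p.2) :
    ∫ z, ∫ w, f z w ∂ρ ∂π = ∫ w, ∫ z, f z w ∂π ∂ρ :=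
  integral_integral_swap (integrable_of_continuous (π.prod ρ) hf)

/-- Jensen's inequality for the square, in the form of the inequality of the means. -/
theorem mul_integral_le (π : Measure K) [IsProbabilityMeasure π] {f : K → ℝ}
    (hf : Continuous f) (c : ℝ) :
    c * ∫ y, f y ∂π ≤ (c ^ 2 + ∫ y, f y ^ 2 ∂π) / 2 := by
  have i1 : Integrable (fun y => f y ^ 2) π := integrable_of_continuous π (by fun_prop)
  have h : ∫ y, c * f y ∂π ≤ ∫ y, (c ^ 2 + f y ^ 2) / 2 ∂π := by
    refine integral_mono ((integrable_of_continuous π hf).const_mul c)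
      (((integrable_const _).add i1).div_const 2) fun y => ?_
    change c * f y ≤ (c ^ 2 + f y ^ 2) / 2
    nlinarith [sq_nonneg (c - f y)]
  rw [integral_const_mul, integral_div, integral_add (integrable_const _) i1] at h
  simpa using h

end Compact

/-! ### The velocity field -/

/-- The mean (order parameter) `∫ z dπ(z)` of a measure on the sphere. -/
noncomputable def mean {d : ℕ} (π : Measure (HS d)) : Cd d := ∫ z : HS d, (z : Cd d) ∂π

/-- The velocity field at `z` generated by a mean `m`. -/
noncomputable def field {d : ℕ} (κ₀ κ₁ : ℝ) (Ω : Matrix (Fin d) (Fin d) ℂ) (m z : Cd d) : Cd d :=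
  Matrix.toEuclideanLin Ω z +
    ((κ₀ : ℂ) • (m - inner ℂ m z • z) + (κ₁ : ℂ) • (inner ℂ z m • z - inner ℂ m z • z))

theorem integrable_coe {d : ℕ} (π : Measure (HS d)) [IsFiniteMeasure π] :
    Integrable (fun z : HS d => (z : Cd d)) π :=
  continuous_subtype_val.integrable_of_hasCompactSupport (HasCompactSupport.of_compactSpace _)

theorem integrable_inner_left {d : ℕ} (π : Measure (HS d)) [IsFiniteMeasure π] (z : Cd d) :
    Integrable (fun y : HS d => inner ℂ (y : Cd d) z) π :=
  (integrable_coe π).inner_const z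

theorem integral_inner_left {d : ℕ} (π : Measure (HS d)) [IsFiniteMeasure π] (z : Cd d) :
    ∫ y : HS d, inner ℂ (y : Cd d) z ∂π = inner ℂ (mean π) z := by
  rw [← inner_conj_symm, mean, ← integral_inner (integrable_coe π), ← integral_conj]
  simp

/-- The velocity depends on the measure only through its mean. -/
theorem velocity_eq_field {d : ℕ} (κ₀ κ₁ : ℝ) (Ω : Matrix (Fin d) (Fin d) ℂ) (π : Measure (HS d))
    [IsProbabilityMeasure π] (z : Cd d) :
    velocity κ₀ κ₁ Ω π z = field κ₀ κ₁ Ω (mean π) z := by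
  have i0 := integrable_coe π
  have i1 : Integrable (fun y : HS d => inner ℂ (y : Cd d) z • z) π :=
    (integrable_inner_left π z).smul_const z
  have i2 : Integrable (fun y : HS d => inner ℂ z (y : Cd d) • z) π :=
    (i0.const_inner z).smul_const z
  have i3 : Integrable (fun y : HS d => (y : Cd d) - inner ℂ (y : Cd d) z • z) π := i0.sub i1
  have i4 : Integrable (fun y : HS d => inner ℂ z (y : Cd d) • z - inner ℂ (y : Cd d) z • z) π :=
    i2.sub i1
  rw [velocity, field, integral_add (i3.fun_smul (κ₀ : ℂ)) (i4.fun_smul (κ₁ : ℂ)), integral_smul,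
    integral_smul, integral_sub i0 i1, integral_sub i2 i1, integral_smul_const,
    integral_smul_const, integral_inner_left, integral_inner i0]
  rfl

theorem continuous_field {d : ℕ} (κ₀ κ₁ : ℝ) (Ω : Matrix (Fin d) (Fin d) ℂ) {X : Type*}
    [TopologicalSpace X] {m z : X → Cd d} (hm : Continuous m) (hz : Continuous z) :
    Continuous fun x => field κ₀ κ₁ Ω (m x) (z x) := by
  have : Continuous (Matrix.toEuclideanLin Ω) := LinearMap.continuous_of_finiteDimensional _
  unfold field
  fun_prop

theorem continuous_mean {d : ℕ} :
    Continuous fun π : ProbabilityMeasure (HS d) => mean (π : Measure (HS d)) := by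
  have h : ∀ i, Continuous fun π : ProbabilityMeasure (HS d) => mean (π : Measure (HS d)) i := by
    intro i
    rw [continuous_iff_continuousAt]
    intro π₀
    have hi : ∀ π : ProbabilityMeasure (HS d),
        mean (π : Measure (HS d)) i = ∫ z : HS d, (z : Cd d) i ∂(π : Measure (HS d)) := fun π =>
      ((EuclideanSpace.proj (𝕜 := ℂ) i).integral_comp_comm (integrable_coe _)).symm
    have hc : Continuous fun z : HS d => (z : Cd d) i := by fun_prop
    have := (ProbabilityMeasure.tendsto_iff_forall_integral_rclike_tendsto ℂ).1
      (tendsto_id (α := ProbabilityMeasure (HS d)) (x := 𝓝 π₀))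
      (BoundedContinuousFunction.mkOfCompact ⟨_, hc⟩)
    simp only [ContinuousAt, hi]
    exact this
  exact (PiLp.continuous_toLp 2 _).comp (continuous_pi h)

theorem inner_toEuclideanLin_add {d : ℕ} {Ω : Matrix (Fin d) (Fin d) ℂ} (hΩ : Ωᴴ = -Ω)
    (z w : Cd d) :
    inner ℂ (Matrix.toEuclideanLin Ω z) w + inner ℂ z (Matrix.toEuclideanLin Ω w) = 0 := by
  rw [← LinearMap.adjoint_inner_right, ← Matrix.toEuclideanLin_conjTranspose_eq_adjoint, hΩ]
  simp

theorem inner_self_sphere {d : ℕ} (z : HS d) : inner ℂ (z : Cd d) (z : Cd d) = 1 := by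
  rw [inner_self_eq_norm_sq_to_K, norm_eq_of_mem_sphere]; simp

/-- Derivative of `⟨z, w⟩` when `z` and `w` both move with the velocity field: the common rotation
`Ω` drops out. -/
theorem inner_field_add {d : ℕ} {κ₀ κ₁ : ℝ} {Ω : Matrix (Fin d) (Fin d) ℂ} (hΩ : Ωᴴ = -Ω)
    (m z w : Cd d) :
    inner ℂ (field κ₀ κ₁ Ω m z) w + inner ℂ z (field κ₀ κ₁ Ω m w) =
      κ₀ * (inner ℂ m w + inner ℂ z m) * (1 - inner ℂ z w) +
        κ₁ * ((inner ℂ m z - inner ℂ z m) - (inner ℂ m w - inner ℂ w m)) * inner ℂ z w := by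
  have h := inner_toEuclideanLin_add hΩ z w
  simp only [field, inner_add_left, inner_add_right, inner_sub_left, inner_sub_right,
    inner_smul_left, inner_smul_right, Complex.conj_ofReal, inner_conj_symm]
  linear_combination h

theorem dot_eq_re_inner {d : ℕ} (z w : Cd d) : dot z w = (inner ℂ z w).re := by
  simp [dot, PiLp.inner_apply, mul_comm]

/-- The velocity field is tangent to the sphere. -/
theorem dot_field {d : ℕ} {κ₀ κ₁ : ℝ} {Ω : Matrix (Fin d) (Fin d) ℂ} (hΩ : Ωᴴ = -Ω)
    (m : Cd d) (z : HS d) : dot (field κ₀ κ₁ Ω m z) z = 0 := by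
  have h := inner_field_add (κ₀ := κ₀) (κ₁ := κ₁) hΩ m (z : Cd d) z
  rw [inner_self_sphere, sub_self, sub_self, mul_zero, mul_zero, zero_mul, add_zero] at h
  have h' := congrArg Complex.re h
  rw [Complex.add_re, ← inner_conj_symm (z : Cd d) (field κ₀ κ₁ Ω m z), Complex.conj_re,
    Complex.zero_re] at h'
  rw [dot_eq_re_inner]
  linarith

/-! ### The weak formulation as a differential equation -/

section Evolution

variable {d : ℕ} {κ₀ κ₁ : ℝ} {Ω : Matrix (Fin d) (Fin d) ℂ} {μ₀ : ProbabilityMeasure (HS d)}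
  {μ : ℝ → ProbabilityMeasure (HS d)}

/-- Freezing the solution at negative times makes it continuous on the whole line. -/
theorem IsMeasureValuedSolution.continuous_max (hμ : IsMeasureValuedSolution κ₀ κ₁ Ω μ₀ μ) :
    Continuous fun t => μ (max t 0) :=
  hμ.continuousOn.comp_continuous (by fun_prop) fun _ => mem_Ici.2 (le_max_right _ _)

/-- The weak formulation for an observable that does not depend on time: the test function is the
observable times a smooth cutoff in time that equals `1` up to time `t`. -/
theorem IsMeasureValuedSolution.integral_sub_integral (hΩ : Ωᴴ = -Ω)
    (hμ : IsMeasureValuedSolution κ₀ κ₁ Ω μ₀ μ) {f : Cd d → ℝ} (hf : ContDiff ℝ 1 f) {t : ℝ}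
    (ht : 0 ≤ t) :
    (∫ z : HS d, f z ∂(μ t : Measure (HS d))) - ∫ z : HS d, f z ∂(μ₀ : Measure (HS d)) =
      ∫ s in (0 : ℝ)..t, ∫ z : HS d,
        fderiv ℝ f z (field κ₀ κ₁ Ω (mean (μ s : Measure (HS d))) z) ∂(μ s : Measure (HS d)) := by
  let χ : ℝ → ℝ := fun s => Real.smoothTransition (t + 2 - s)
  have hχ1 : ∀ s, s ≤ t + 1 → χ s = 1 := fun s hs =>
    Real.smoothTransition.one_of_one_le (by linarith)
  have hφ : IsTestFunction fun p : ℝ × Cd d => χ p.1 * f p.2 := by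
    refine ⟨?_, t + 2, fun s hs z => ?_⟩
    · have : ContDiff ℝ 1 χ := Real.smoothTransition.contDiff.comp (by fun_prop)
      exact (this.comp contDiff_fst).mul (hf.comp contDiff_snd)
    · have : χ s = 0 := Real.smoothTransition.zero_of_nonpos (by linarith)
      simp [this]
  have h := hμ.weak _ hφ t ht
  simp only [hχ1 t (by linarith), hχ1 0 (by linarith), one_mul] at h
  rw [h]
  refine intervalIntegral.integral_congr fun s hs => ?_
  rw [uIcc_of_le ht] at hs
  refine integral_congr_ae (ae_of_all _ fun z => ?_)
  have h1 : deriv (fun τ => χ τ * f z) s = 0 := by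
    have : (fun τ => χ τ * f z) =ᶠ[𝓝 s] fun _ => f z := by
      filter_upwards [Iio_mem_nhds (show s < t + 1 by linarith [hs.2])] with τ hτ
      rw [hχ1 τ hτ.le, one_mul]
    rw [this.deriv_eq, deriv_const]
  simp only [h1, hχ1 s (by linarith [hs.2]), one_mul, zero_add]
  rw [velocity_eq_field]
  exact dot_covGrad _ _ _ (dot_field hΩ _ z)

theorem IsMeasureValuedSolution.hasDerivAt_integral (hΩ : Ωᴴ = -Ω)
    (hμ : IsMeasureValuedSolution κ₀ κ₁ Ω μ₀ μ) {f : Cd d → ℝ} (hf : ContDiff ℝ 1 f) {t : ℝ}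
    (ht : 0 < t) :
    HasDerivAt (fun s => ∫ z : HS d, f z ∂(μ s : Measure (HS d)))
      (∫ z : HS d, fderiv ℝ f z (field κ₀ κ₁ Ω (mean (μ t : Measure (HS d))) z)
        ∂(μ t : Measure (HS d))) t := by
  have hν := hμ.continuous_max
  set ν : ℝ → ProbabilityMeasure (HS d) := fun s => μ (max s 0)
  have hνμ : ∀ s, 0 ≤ s → ν s = μ s := fun s hs => by simp [ν, hs]
  let q : ℝ → ℝ := fun s => ∫ z : HS d,
    fderiv ℝ f z (field κ₀ κ₁ Ω (mean (ν s : Measure (HS d))) z) ∂(ν s : Measure (HS d))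
  have hq : Continuous q := by
    have hG : Continuous fun p : ℝ × HS d =>
        fderiv ℝ f (p.2 : Cd d) (field κ₀ κ₁ Ω (mean (ν p.1 : Measure (HS d))) p.2) := by
      have h1 : Continuous fun p : ℝ × HS d => fderiv ℝ f (p.2 : Cd d) :=
        (hf.continuous_fderiv one_ne_zero).comp (by fun_prop)
      have h2 : Continuous fun p : ℝ × HS d => mean (ν p.1 : Measure (HS d)) :=
        (continuous_mean.comp hν).comp continuous_fst
      have h3 : Continuous fun p : ℝ × HS d =>
          field κ₀ κ₁ Ω (mean (ν p.1 : Measure (HS d))) (p.2 : Cd d) :=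
        continuous_field κ₀ κ₁ Ω h2 (by fun_prop)
      exact h1.clm_apply h3
    exact continuous_integral_comp hG hν
  have hd : HasDerivAt (fun s => (∫ z : HS d, f z ∂(μ₀ : Measure (HS d))) + ∫ r in (0 : ℝ)..s, q r)
      (q t) t := (hq.integral_hasStrictDerivAt 0 t).hasDerivAt.const_add _
  have hqt : q t = ∫ z : HS d, fderiv ℝ f z (field κ₀ κ₁ Ω (mean (μ t : Measure (HS d))) z)
        ∂(μ t : Measure (HS d)) := by simp only [q, hνμ t ht.le]
  rw [← hqt]
  refine hd.congr_of_eventuallyEq ?_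
  filter_upwards [Ioi_mem_nhds ht] with s hs
  have hs0 : 0 ≤ s := le_of_lt hs
  rw [← sub_eq_iff_eq_add', hμ.integral_sub_integral hΩ hf hs0]
  refine intervalIntegral.integral_congr fun r hr => ?_
  rw [uIcc_of_le hs0] at hr
  simp only [q, hνμ r hr.1]

/-- Evolution of an interaction energy `∬ φ(z, w) dμ_t(z) dμ_t(w)` with a symmetric kernel `φ`.
`D z w v` is the derivative of `φ(·, w)` at `z` in direction `v`. -/
theorem IsMeasureValuedSolution.hasDerivAt_integral_integral (hΩ : Ωᴴ = -Ω)
    (hμ : IsMeasureValuedSolution κ₀ κ₁ Ω μ₀ μ) {φ : Cd d → Cd d → ℝ} {D : Cd d → Cd d → Cd d → ℝ}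
    (hφ : Continuous fun p : Cd d × Cd d => φ p.1 p.2)
    (hφ1 : ∀ w, ContDiff ℝ 1 fun z => φ z w) (hsymm : ∀ z w, φ z w = φ w z)
    (hD : ∀ z w v, fderiv ℝ (fun x => φ x w) z v = D z w v)
    (hDc : Continuous fun p : (Cd d × Cd d) × Cd d => D p.1.1 p.1.2 p.2) {t : ℝ} (ht : 0 < t) :
    HasDerivAt (fun s => ∫ w : HS d, ∫ z : HS d, φ z w ∂(μ s : Measure (HS d))
        ∂(μ s : Measure (HS d)))
      (∫ w : HS d, ∫ z : HS d,
        (D z w (field κ₀ κ₁ Ω (mean (μ t : Measure (HS d))) z) +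
          D w z (field κ₀ κ₁ Ω (mean (μ t : Measure (HS d))) w))
          ∂(μ t : Measure (HS d)) ∂(μ t : Measure (HS d))) t := by
  have hν := hμ.continuous_max
  set ν : ℝ → ProbabilityMeasure (HS d) := fun s => μ (max s 0)
  have hνμ : ∀ s, 0 ≤ s → ν s = μ s := fun s hs => by simp [ν, hs]
  -- `Φ` decouples the two copies of the measure, and `P` is its partial derivative in the first
  -- time. By symmetry of `φ` the other partial derivative is `P r s`.
  let Φ : ℝ → ℝ → ℝ := fun s r => ∫ w : HS d, ∫ z : HS d, φ z w ∂(ν s : Measure (HS d))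
    ∂(ν r : Measure (HS d))
  let Q : ℝ → HS d → ℝ := fun s w => ∫ z : HS d,
    D z w (field κ₀ κ₁ Ω (mean (ν s : Measure (HS d))) z) ∂(ν s : Measure (HS d))
  let P : ℝ → ℝ → ℝ := fun s r => ∫ w : HS d, Q s w ∂(ν r : Measure (HS d))
  have hint : Continuous fun p : (ℝ × HS d) × HS d =>
      D p.2 p.1.2 (field κ₀ κ₁ Ω (mean (ν p.1.1 : Measure (HS d))) p.2) := by
    have h2 : Continuous fun p : (ℝ × HS d) × HS d => mean (ν p.1.1 : Measure (HS d)) :=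
      (continuous_mean.comp hν).comp (by fun_prop)
    have h3 : Continuous fun p : (ℝ × HS d) × HS d =>
        field κ₀ κ₁ Ω (mean (ν p.1.1 : Measure (HS d))) p.2 :=
      continuous_field κ₀ κ₁ Ω h2 (by fun_prop)
    exact hDc.comp ((Continuous.prodMk (by fun_prop) (by fun_prop)).prodMk h3)
  have hQ : Continuous fun p : ℝ × HS d => Q p.1 p.2 :=
    continuous_integral_comp hint (hν.comp continuous_fst)
  have hP : Continuous fun p : ℝ × ℝ => P p.1 p.2 := by
    have : Continuous fun p : (ℝ × ℝ) × HS d => Q p.1.1 p.2 :=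
      hQ.comp (by fun_prop : Continuous fun p : (ℝ × ℝ) × HS d => (p.1.1, p.2))
    exact continuous_integral_comp this (hν.comp continuous_snd)
  have hΦw : ∀ s, Continuous fun w : HS d => ∫ z : HS d, φ z w ∂(ν s : Measure (HS d)) := fun s =>
    continuous_integral_of_continuous _ (hφ.comp (by fun_prop :
      Continuous fun p : HS d × HS d => ((p.2 : Cd d), (p.1 : Cd d))))
  have hΦ1 : ∀ s, 0 < s → ∀ r, HasDerivAt (fun s => Φ s r) (P s r) s := by
    intro s hs r
    obtain ⟨C, hC⟩ := ((isCompact_Icc (a := s / 2) (b := 2 * s)).prod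
      (isCompact_univ (X := HS d))).exists_bound_of_continuousOn hQ.continuousOn
    refine (hasDerivAt_integral_of_dominated_loc_of_deriv_le (bound := fun _ => C)
      (s := Icc (s / 2) (2 * s)) (Icc_mem_nhds (by linarith) (by linarith))
      (.of_forall fun s => (hΦw s).aestronglyMeasurable) (integrable_of_continuous _ (hΦw s))
      (F' := Q) (hQ.comp (by fun_prop : Continuous fun w => (s, w))).aestronglyMeasurable
      (ae_of_all _ fun w x hx => hC (x, w) ⟨hx, mem_univ _⟩) (integrable_const C)
      (ae_of_all _ fun w x hx => ?_)).2
    have hx0 : 0 < x := by linarith [hx.1]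
    have := hμ.hasDerivAt_integral hΩ (hφ1 w) hx0
    simp only [hD, ← hνμ x hx0.le] at this
    refine this.congr_of_eventuallyEq ?_
    filter_upwards [Ioi_mem_nhds hx0] with y hy
    rw [hνμ y (le_of_lt hy)]
  have hΦs : ∀ s r, Φ s r = Φ r s := by
    intro s r
    simp only [Φ]
    rw [integral_swap_of_continuous (f := fun w z : HS d => φ z w) _ _ (hφ.comp (by fun_prop :
      Continuous fun p : HS d × HS d => ((p.2 : Cd d), (p.1 : Cd d))))]
    simp only [hsymm]
  have hev1 : ∀ᶠ v : ℝ × ℝ in 𝓝 (t, t), 0 < v.1 := continuousAt_fst.eventually (Ioi_mem_nhds ht)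
  have hev2 : ∀ᶠ v : ℝ × ℝ in 𝓝 (t, t), 0 < v.2 := continuousAt_snd.eventually (Ioi_mem_nhds ht)
  have hspan : Continuous fun a : ℝ => ContinuousLinearMap.toSpanSingleton ℝ a :=
    (ContinuousLinearMap.toSpanSingletonLE ℝ ℝ ℝ).toLinearMap.continuous_of_finiteDimensional
  have hmain := hasStrictFDerivAt_uncurry_coprod (u := (t, t)) (f := Φ)
    (f₁ := fun s r => ContinuousLinearMap.toSpanSingleton ℝ (P s r))
    (f₂ := fun s r => ContinuousLinearMap.toSpanSingleton ℝ (P r s))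
    (hev1.mono fun v hv => (hΦ1 v.1 hv v.2).hasFDerivAt)
    (hev2.mono fun v hv => by
      have := (hΦ1 v.2 hv v.1).hasFDerivAt
      simp only [hΦs _ v.1] at this
      exact this)
    (hspan.comp hP).continuousAt
    (hspan.comp (hP.comp (by fun_prop : Continuous fun p : ℝ × ℝ => (p.2, p.1)))).continuousAt
  have hdiag : HasDerivAt (fun s : ℝ => (s, s)) ((1 : ℝ), (1 : ℝ)) t :=
    (hasDerivAt_id t).prodMk (hasDerivAt_id t)
  have hfin := hmain.hasFDerivAt.comp_hasDerivAt_of_eq t hdiag rfl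
  have hval : P t t + P t t = ∫ w : HS d, ∫ z : HS d,
        (D z w (field κ₀ κ₁ Ω (mean (μ t : Measure (HS d))) z) +
          D w z (field κ₀ κ₁ Ω (mean (μ t : Measure (HS d))) w))
          ∂(μ t : Measure (HS d)) ∂(μ t : Measure (HS d)) := by
    simp only [P, Q, hνμ t ht.le]
    have c1 : Continuous fun p : HS d × HS d =>
        D p.2 p.1 (field κ₀ κ₁ Ω (mean (μ t : Measure (HS d))) p.2) := by
      have := (hint).comp (by fun_prop : Continuous fun p : HS d × HS d => ((t, p.1), p.2))
      simpa only [Function.comp_def, hνμ t ht.le] using this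
    have c2 : Continuous fun p : HS d × HS d =>
        D p.1 p.2 (field κ₀ κ₁ Ω (mean (μ t : Measure (HS d))) p.1) :=
      c1.comp continuous_swap
    have e : ∀ w : HS d, ∫ z : HS d,
        (D z w (field κ₀ κ₁ Ω (mean (μ t : Measure (HS d))) z) +
          D w z (field κ₀ κ₁ Ω (mean (μ t : Measure (HS d))) w)) ∂(μ t : Measure (HS d)) =
        (∫ z : HS d, D z w (field κ₀ κ₁ Ω (mean (μ t : Measure (HS d))) z)
          ∂(μ t : Measure (HS d))) +
        ∫ z : HS d, D w z (field κ₀ κ₁ Ω (mean (μ t : Measure (HS d))) w)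
          ∂(μ t : Measure (HS d)) := fun w =>
      integral_add (integrable_of_continuous _ (c1.comp (by fun_prop : Continuous fun z => (w, z))))
        (integrable_of_continuous _ (c2.comp (by fun_prop : Continuous fun z => (w, z))))
    simp only [e]
    rw [integral_add (integrable_of_continuous _ (continuous_integral_of_continuous _ c1))
      (integrable_of_continuous _ (continuous_integral_of_continuous _ c2)),
      integral_swap_of_continuous (f := fun w z : HS d =>
        D w z (field κ₀ κ₁ Ω (mean (μ t : Measure (HS d))) w)) _ _ c2]
  rw [← hval]
  have hfin' : HasDerivAt (fun s => Φ s s) (P t t + P t t) t := by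
    simpa [Function.comp_def, Function.HasUncurry.uncurry] using hfin
  refine hfin'.congr_of_eventuallyEq ?_
  filter_upwards [Ioi_mem_nhds ht] with s hs
  simp only [Φ, hνμ s (le_of_lt hs)]

theorem IsMeasureValuedSolution.continuousOn_integral_integral
    (hμ : IsMeasureValuedSolution κ₀ κ₁ Ω μ₀ μ) {φ : Cd d → Cd d → ℝ}
    (hφ : Continuous fun p : Cd d × Cd d => φ p.1 p.2) :
    ContinuousOn (fun s => ∫ w : HS d, ∫ z : HS d, φ z w ∂(μ s : Measure (HS d))
        ∂(μ s : Measure (HS d))) (Ici 0) := by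
  have h1 : Continuous fun p : (ℝ × HS d) × HS d => φ p.2 p.1.2 :=
    hφ.comp (by fun_prop : Continuous fun p : (ℝ × HS d) × HS d => ((p.2 : Cd d), (p.1.2 : Cd d)))
  have h2 : Continuous fun p : ℝ × HS d =>
      ∫ z : HS d, φ z p.2 ∂(μ (max p.1 0) : Measure (HS d)) :=
    continuous_integral_comp h1 (hμ.continuous_max.comp continuous_fst)
  have h3 := continuous_integral_comp (G := fun s (w : HS d) =>
      ∫ z : HS d, φ z w ∂(μ (max s 0) : Measure (HS d))) h2 hμ.continuous_max
  refine h3.continuousOn.congr fun s hs => ?_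
  simp only [max_eq_left (mem_Ici.1 hs)]

end Evolution

/-! ### The gap between two points -/

section Gap

variable {d : ℕ}

/-- The deviation `|1 - ⟨z, w⟩|` of two points from each other. -/
noncomputable def gap (z w : Cd d) : ℝ := ‖1 - inner ℂ z w‖

theorem gap_nonneg (z w : Cd d) : 0 ≤ gap z w := norm_nonneg _

theorem gap_comm (z w : Cd d) : gap z w = gap w z := by
  rw [gap, gap, ← inner_conj_symm w z, ← map_one (starRingEnd ℂ), ← map_sub, RCLike.norm_conj,
    map_one]

theorem norm_inner_le_one (z w : HS d) : ‖inner ℂ (z : Cd d) (w : Cd d)‖ ≤ 1 := by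
  simpa using norm_inner_le_norm (𝕜 := ℂ) (z : Cd d) (w : Cd d)

theorem gap_le_two (z w : HS d) : gap (z : Cd d) w ≤ 2 := by
  refine (norm_sub_le _ _).trans ?_
  rw [norm_one]
  linarith [norm_inner_le_one z w]

theorem continuous_gap {X : Type*} [TopologicalSpace X] {f g : X → Cd d} (hf : Continuous f)
    (hg : Continuous g) : Continuous fun x => gap (f x) (g x) := by
  unfold gap; fun_prop

theorem continuous_gap_sphere : Continuous fun p : HS d × HS d => gap (p.1 : Cd d) p.2 :=
  continuous_gap (continuous_subtype_val.comp continuous_fst)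
    (continuous_subtype_val.comp continuous_snd)

/-- The derivative of `|1 - ⟨z, w⟩|²` when `z` moves in direction `v`. -/
noncomputable def gapSqDeriv (z w v : Cd d) : ℝ := -2 * (conj (1 - inner ℂ z w) * inner ℂ v w).re

theorem contDiff_gap_sq (w : Cd d) : ContDiff ℝ 1 fun z => gap z w ^ 2 := by
  unfold gap
  exact ContDiff.norm_sq ℝ (contDiff_const.sub (contDiff_id.inner ℂ contDiff_const))

theorem fderiv_gap_sq (z w v : Cd d) :
    fderiv ℝ (fun x => gap x w ^ 2) z v = gapSqDeriv z w v := by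
  have h1 : HasFDerivAt (fun x : Cd d => 1 - inner ℂ x w) _ z :=
    ((hasFDerivAt_id (𝕜 := ℝ) z).inner ℂ (hasFDerivAt_const w z)).const_sub 1
  have h2 := h1.norm_sq
  unfold gap gapSqDeriv
  rw [h2.fderiv]
  simp [Complex.inner, mul_comm]
  ring

theorem gapSqDeriv_add (m z w : Cd d) (κ₀ κ₁ : ℝ) (Ω : Matrix (Fin d) (Fin d) ℂ) :
    gapSqDeriv z w (field κ₀ κ₁ Ω m z) + gapSqDeriv w z (field κ₀ κ₁ Ω m w) =
      -2 * (conj (1 - inner ℂ z w) *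
        (inner ℂ (field κ₀ κ₁ Ω m z) w + inner ℂ z (field κ₀ κ₁ Ω m w))).re := by
  have h : (conj (1 - inner ℂ w z) * inner ℂ (field κ₀ κ₁ Ω m w) z : ℂ).re =
      (conj (1 - inner ℂ z w) * inner ℂ z (field κ₀ κ₁ Ω m w) : ℂ).re := by
    rw [← Complex.conj_re]
    simp only [map_mul, map_sub, map_one, inner_conj_symm]
  rw [gapSqDeriv, gapSqDeriv, h, mul_add, Complex.add_re]
  ring

/-- Along the flow the attraction `κ₀` decreases the gap at the rate of the overlap of both points
with the mean, while the phase coupling `κ₁` only sees imaginary parts. -/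
theorem gapSqDeriv_add_le {κ₀ κ₁ : ℝ} {Ω : Matrix (Fin d) (Fin d) ℂ} (hΩ : Ωᴴ = -Ω) (m : Cd d)
    (z w : HS d) :
    gapSqDeriv (z : Cd d) w (field κ₀ κ₁ Ω m z) + gapSqDeriv (w : Cd d) z (field κ₀ κ₁ Ω m w) ≤
      -2 * κ₀ * gap (z : Cd d) w ^ 2 * ((inner ℂ m (z : Cd d)).re + (inner ℂ m (w : Cd d)).re) +
        4 * |κ₁| * gap (z : Cd d) w *
          (|(inner ℂ m (z : Cd d)).im| + |(inner ℂ m (w : Cd d)).im|) := by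
  rw [gapSqDeriv_add, inner_field_add hΩ]
  set h : ℂ := inner ℂ (z : Cd d) (w : Cd d) with hh
  set A : ℂ := inner ℂ m (z : Cd d) with hA
  set B : ℂ := inner ℂ m (w : Cd d) with hB
  have hA' : inner ℂ (z : Cd d) m = conj A := by rw [hA, inner_conj_symm]
  have hB' : inner ℂ (w : Cd d) m = conj B := by rw [hB, inner_conj_symm]
  have hg : gap (z : Cd d) w = ‖1 - h‖ := rfl
  have hg2 : ‖1 - h‖ ^ 2 = (1 - h.re) ^ 2 + h.im ^ 2 := by
    rw [← Complex.normSq_eq_norm_sq, Complex.normSq_apply]; simp; ring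
  rw [hA', hB', hg]
  have h1 : (conj (1 - h) * (κ₀ * (B + conj A) * (1 - h) +
      κ₁ * ((A - conj A) - (B - conj B)) * h)).re =
      κ₀ * ‖1 - h‖ ^ 2 * (A.re + B.re) - 2 * κ₁ * (A.im - B.im) * (conj (1 - h) * h).im := by
    rw [hg2]
    simp
    ring
  have h2 : |(conj (1 - h) * h).im| ≤ ‖1 - h‖ := by
    refine (Complex.abs_im_le_norm _).trans ?_
    rw [norm_mul, RCLike.norm_conj]
    exact mul_le_of_le_one_right (norm_nonneg _) (norm_inner_le_one z w)
  have h3 : κ₁ * (A.im - B.im) * (conj (1 - h) * h).im ≤ |κ₁| * (|A.im| + |B.im|) * ‖1 - h‖ := by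
    refine (le_abs_self _).trans ?_
    rw [abs_mul, abs_mul]
    gcongr
    exact abs_sub _ _
  rw [h1]
  linarith

end Gap

/-! ### Averages over pairs of points -/

section Average

variable {d : ℕ} (π : Measure (HS d)) [IsProbabilityMeasure π]

/-- The average gap to `z`. -/
noncomputable def meanGap (z : Cd d) : ℝ := ∫ y : HS d, gap (y : Cd d) z ∂π

theorem norm_one_sub_inner_mean_le (z : Cd d) : ‖1 - inner ℂ (mean π) z‖ ≤ meanGap π z := by
  have : 1 - inner ℂ (mean π) z = ∫ y : HS d, (1 - inner ℂ (y : Cd d) z) ∂π := by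
    rw [integral_sub (integrable_const _) (integrable_inner_left π z), integral_inner_left]
    simp
  rw [this]
  exact norm_integral_le_integral_norm _

theorem one_sub_meanGap_le_re (z : Cd d) : 1 - meanGap π z ≤ (inner ℂ (mean π) z).re := by
  have h := (Complex.re_le_norm _).trans (norm_one_sub_inner_mean_le π z)
  simp only [Complex.sub_re, Complex.one_re] at h
  linarith

theorem abs_im_le_meanGap (z : Cd d) : |(inner ℂ (mean π) z).im| ≤ meanGap π z := by
  have h := (Complex.abs_im_le_norm _).trans (norm_one_sub_inner_mean_le π z)
  simpa using h

variable {π} {q : HS d → HS d → ℝ}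

theorem continuous_section (hq : Continuous fun p : HS d × HS d => q p.1 p.2) (z : HS d) :
    Continuous fun y => q y z :=
  hq.comp (by fun_prop : Continuous fun y => (y, z))

theorem continuous_average (hq : Continuous fun p : HS d × HS d => q p.1 p.2) :
    Continuous fun z => ∫ y, q y z ∂π :=
  continuous_integral_of_continuous π
    (hq.comp (by fun_prop : Continuous fun p : HS d × HS d => (p.2, p.1)))

theorem integral_prod_average_fst (hq : Continuous fun p : HS d × HS d => q p.1 p.2) :
    ∫ p : HS d × HS d, ∫ y, q y p.1 ∂π ∂(π.prod π) = ∫ p : HS d × HS d, q p.1 p.2 ∂(π.prod π) := by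
  rw [integral_fun_fst (fun z => ∫ y, q y z ∂π),
    integral_prod_symm _ (integrable_of_continuous _ hq)]
  simp

theorem integral_prod_average_snd (hq : Continuous fun p : HS d × HS d => q p.1 p.2) :
    ∫ p : HS d × HS d, ∫ y, q y p.2 ∂π ∂(π.prod π) = ∫ p : HS d × HS d, q p.1 p.2 ∂(π.prod π) := by
  rw [integral_fun_snd (fun z => ∫ y, q y z ∂π),
    integral_prod_symm _ (integrable_of_continuous _ hq)]
  simp

theorem integral_prod_average_add (hq : Continuous fun p : HS d × HS d => q p.1 p.2) :
    ∫ p : HS d × HS d, (∫ y, q y p.1 ∂π + ∫ y, q y p.2 ∂π) ∂(π.prod π) =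
      2 * ∫ p : HS d × HS d, q p.1 p.2 ∂(π.prod π) := by
  have hc := continuous_average (π := π) hq
  have i1 : Integrable (fun p : HS d × HS d => ∫ y, q y p.1 ∂π) (π.prod π) :=
    integrable_of_continuous _ (hc.comp continuous_fst)
  have i2 : Integrable (fun p : HS d × HS d => ∫ y, q y p.2 ∂π) (π.prod π) :=
    integrable_of_continuous _ (hc.comp continuous_snd)
  rw [integral_add i1 i2, integral_prod_average_fst hq,
    integral_prod_average_snd hq]
  ring

/-- A third point, averaged over, can be traded for the pair: the bound that closes the
differential inequalities. -/
theorem integral_prod_mul_average_le (hq : Continuous fun p : HS d × HS d => q p.1 p.2) :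
    ∫ p : HS d × HS d, q p.1 p.2 * (∫ y, q y p.1 ∂π + ∫ y, q y p.2 ∂π) ∂(π.prod π) ≤
      2 * ∫ p : HS d × HS d, q p.1 p.2 ^ 2 ∂(π.prod π) := by
  have hq2 : Continuous fun p : HS d × HS d => q p.1 p.2 ^ 2 := hq.pow 2
  have hc := continuous_average (π := π) hq
  have hc2 := continuous_average (π := π) (q := fun y z => q y z ^ 2) hq2
  have hs : Continuous fun p : HS d × HS d => ∫ y, q y p.1 ^ 2 ∂π + ∫ y, q y p.2 ^ 2 ∂π :=
    (hc2.comp continuous_fst).add (hc2.comp continuous_snd)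
  have h : ∫ p : HS d × HS d, q p.1 p.2 * (∫ y, q y p.1 ∂π + ∫ y, q y p.2 ∂π) ∂(π.prod π) ≤
      ∫ p : HS d × HS d, (q p.1 p.2 ^ 2 +
        1 / 2 * (∫ y, q y p.1 ^ 2 ∂π + ∫ y, q y p.2 ^ 2 ∂π)) ∂(π.prod π) := by
    refine integral_mono (integrable_of_continuous _
      (hq.mul ((hc.comp continuous_fst).add (hc.comp continuous_snd))))
      (integrable_of_continuous _ (hq2.add (continuous_const.mul hs))) fun p => ?_
    have h1 := mul_integral_le π (continuous_section hq p.1) (q p.1 p.2)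
    have h2 := mul_integral_le π (continuous_section hq p.2) (q p.1 p.2)
    simp only
    linarith
  rw [integral_add (integrable_of_continuous _ hq2)
    ((integrable_of_continuous _ hs).const_mul _), integral_const_mul,
    integral_prod_average_add (q := fun y z => q y z ^ 2) hq2] at h
  linarith

theorem abs_one_sub_norm_mean_sq_le :
    |1 - ‖mean π‖ ^ 2| ≤ ∫ p : HS d × HS d, gap (p.1 : Cd d) p.2 ∂(π.prod π) := by
  have h1 : (1 : ℂ) - ((‖mean π‖ ^ 2 : ℝ) : ℂ) =
      ∫ z : HS d, (1 - inner ℂ (mean π) (z : Cd d)) ∂π := by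
    rw [integral_sub (integrable_const _) ((integrable_coe π).const_inner _),
      integral_inner (integrable_coe π)]
    change _ = _ - inner ℂ (mean π) (mean π)
    rw [inner_self_eq_norm_sq_to_K]
    simp
  have hc : Continuous fun z : HS d => meanGap π (z : Cd d) :=
    continuous_average (q := fun y z : HS d => gap (y : Cd d) z) continuous_gap_sphere
  have h2 : ‖(1 : ℂ) - ((‖mean π‖ ^ 2 : ℝ) : ℂ)‖ ≤ ∫ z : HS d, meanGap π (z : Cd d) ∂π := by
    rw [h1]
    exact norm_integral_le_of_norm_le (integrable_of_continuous _ hc)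
      (ae_of_all _ fun z => norm_one_sub_inner_mean_le π z)
  rw [integral_prod_symm _ (integrable_of_continuous _ continuous_gap_sphere)]
  rw [← Complex.ofReal_one, ← Complex.ofReal_sub, Complex.norm_real, Real.norm_eq_abs] at h2
  exact h2

end Average

/-! ### Differential inequalities for the gap -/

theorem hasDerivAt_max_zero_sq (x : ℝ) : HasDerivAt (fun x : ℝ => max x 0 ^ 2) (2 * max x 0) x := by
  rcases lt_trichotomy x 0 with h | rfl | h
  · have : (fun x : ℝ => max x 0 ^ 2) =ᶠ[𝓝 x] fun _ => 0 := by
      filter_upwards [Iio_mem_nhds h] with y hy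
      simp [max_eq_right (le_of_lt (mem_Iio.1 hy))]
    rw [max_eq_right h.le, mul_zero]
    exact (hasDerivAt_const x (0 : ℝ)).congr_of_eventuallyEq this
  · have h : (fun x : ℝ => max x 0 ^ 2) =O[𝓝 0] fun x => ‖x - 0‖ ^ 2 := by
      refine Asymptotics.IsBigO.of_bound 1 (.of_forall fun y => ?_)
      rw [sub_zero, norm_pow, norm_pow, norm_norm, one_mul, Real.norm_eq_abs, Real.norm_eq_abs,
        abs_of_nonneg (le_max_right y 0)]
      exact pow_le_pow_left₀ (le_max_right _ _) (max_le (le_abs_self y) (abs_nonneg y)) 2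
    have := (h.hasFDerivAt one_lt_two).hasDerivAt
    simpa using this
  · have : (fun x : ℝ => max x 0 ^ 2) =ᶠ[𝓝 x] fun x => x ^ 2 := by
      filter_upwards [Ioi_mem_nhds h] with y hy
      rw [max_eq_left (le_of_lt (mem_Ioi.1 hy))]
    rw [max_eq_left h.le]
    simpa using (hasDerivAt_pow 2 x).congr_of_eventuallyEq this

/-- Grönwall's inequality on `[0, ∞)`, for a function that need not be differentiable at `0`. -/
theorem le_mul_exp_of_hasDerivAt_le {f f' : ℝ → ℝ} {k : ℝ} (hc : ContinuousOn f (Ici 0))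
    (hd : ∀ t, 0 < t → HasDerivAt f (f' t) t) (hk : ∀ t, 0 < t → f' t ≤ k * f t) {t : ℝ}
    (ht : 0 ≤ t) : f t ≤ f 0 * Real.exp (k * t) := by
  have hd' : ∀ s, 0 < s → HasDerivAt (fun s => f s * Real.exp (-(k * s)))
      (f' s * Real.exp (-(k * s)) + f s * (Real.exp (-(k * s)) * -(k * 1))) s := fun s hs =>
    (hd s hs).mul (((hasDerivAt_id s).const_mul k).neg.exp)
  have hanti : AntitoneOn (fun s => f s * Real.exp (-(k * s))) (Ici 0) := by
    refine antitoneOn_of_deriv_nonpos (convex_Ici 0) (hc.mul (by fun_prop)) ?_ ?_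
    · rw [interior_Ici]
      exact fun s hs => (hd' s hs).differentiableAt.differentiableWithinAt
    · rw [interior_Ici]
      intro s hs
      rw [(hd' s hs).deriv]
      nlinarith [hk s hs, Real.exp_pos (-(k * s))]
  have h := hanti (mem_Ici.2 le_rfl) (mem_Ici.2 ht) ht
  simp only [mul_zero, neg_zero, Real.exp_zero, mul_one] at h
  rwa [Real.exp_neg, ← div_eq_mul_inv, div_le_iff₀ (Real.exp_pos _)] at h

section Evolution

variable {d : ℕ} {κ₀ κ₁ : ℝ} {Ω : Matrix (Fin d) (Fin d) ℂ} {μ₀ : ProbabilityMeasure (HS d)}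
  {μ : ℝ → ProbabilityMeasure (HS d)}

/-- The rate of change of `|1 - ⟨z, w⟩|²` when both points move with the velocity field of the
mean `m`. -/
noncomputable def gapSqRate (κ₀ κ₁ : ℝ) (Ω : Matrix (Fin d) (Fin d) ℂ) (m z w : Cd d) : ℝ :=
  gapSqDeriv z w (field κ₀ κ₁ Ω m z) + gapSqDeriv w z (field κ₀ κ₁ Ω m w)

theorem continuous_gapSqDeriv {X : Type*} [TopologicalSpace X] {f g h : X → Cd d}
    (hf : Continuous f) (hg : Continuous g) (hh : Continuous h) :
    Continuous fun x => gapSqDeriv (f x) (g x) (h x) := by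
  unfold gapSqDeriv
  have h1 : Continuous fun x => conj (1 - inner ℂ (f x) (g x)) * inner ℂ (h x) (g x) := by fun_prop
  exact continuous_const.mul (Complex.continuous_re.comp h1)

theorem continuous_gapSqRate (m : Cd d) :
    Continuous fun p : HS d × HS d => gapSqRate κ₀ κ₁ Ω m p.1 p.2 := by
  have h1 : Continuous fun p : HS d × HS d => (p.1 : Cd d) := by fun_prop
  have h2 : Continuous fun p : HS d × HS d => (p.2 : Cd d) := by fun_prop
  exact (continuous_gapSqDeriv h1 h2 (continuous_field κ₀ κ₁ Ω continuous_const h1)).add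
    (continuous_gapSqDeriv h2 h1 (continuous_field κ₀ κ₁ Ω continuous_const h2))

/-- Evolution of the interaction energy with kernel `ψ(|1 - ⟨z, w⟩|²)`. -/
theorem IsMeasureValuedSolution.hasDerivAt_integral_gap (hΩ : Ωᴴ = -Ω)
    (hμ : IsMeasureValuedSolution κ₀ κ₁ Ω μ₀ μ) {ψ ψ' : ℝ → ℝ} (hψ : ∀ x, HasDerivAt ψ (ψ' x) x)
    (hψ' : Continuous ψ') {t : ℝ} (ht : 0 < t) :
    HasDerivAt (fun s => ∫ p : HS d × HS d, ψ (gap (p.1 : Cd d) p.2 ^ 2)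
        ∂((μ s : Measure (HS d)).prod (μ s : Measure (HS d))))
      (∫ p : HS d × HS d, ψ' (gap (p.1 : Cd d) p.2 ^ 2) *
          gapSqRate κ₀ κ₁ Ω (mean (μ t : Measure (HS d))) p.1 p.2
        ∂((μ t : Measure (HS d)).prod (μ t : Measure (HS d)))) t := by
  have hψc : Continuous ψ := continuous_iff_continuousAt.2 fun x => (hψ x).continuousAt
  have hψ1 : ContDiff ℝ 1 ψ := by
    rw [contDiff_one_iff_deriv, funext fun x => (hψ x).deriv]
    exact ⟨fun x => (hψ x).differentiableAt, hψ'⟩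
  have hφ : Continuous fun p : Cd d × Cd d => ψ (gap p.1 p.2 ^ 2) :=
    hψc.comp ((continuous_gap continuous_fst continuous_snd).pow 2)
  have hDc : Continuous fun p : (Cd d × Cd d) × Cd d =>
      ψ' (gap p.1.1 p.1.2 ^ 2) * gapSqDeriv p.1.1 p.1.2 p.2 :=
    (hψ'.comp ((continuous_gap (by fun_prop) (by fun_prop)).pow 2)).mul
      (continuous_gapSqDeriv (by fun_prop) (by fun_prop) (by fun_prop))
  have hD : ∀ z w v : Cd d, fderiv ℝ (fun x => ψ (gap x w ^ 2)) z v =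
      ψ' (gap z w ^ 2) * gapSqDeriv z w v := by
    intro z w v
    have h1 : HasFDerivAt (fun x => gap x w ^ 2) (fderiv ℝ (fun x => gap x w ^ 2) z) z :=
      ((contDiff_gap_sq w).differentiable one_ne_zero z).hasFDerivAt
    have h2 := (hψ (gap z w ^ 2)).comp_hasFDerivAt z h1
    have h3 : fderiv ℝ (fun x => ψ (gap x w ^ 2)) z =
        ψ' (gap z w ^ 2) • fderiv ℝ (fun x => gap x w ^ 2) z := h2.fderiv
    rw [h3, _root_.smul_apply, fderiv_gap_sq, smul_eq_mul]
  have h := hμ.hasDerivAt_integral_integral hΩ (φ := fun z w => ψ (gap z w ^ 2))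
    (D := fun z w v => ψ' (gap z w ^ 2) * gapSqDeriv z w v) hφ
    (fun w => hψ1.comp (contDiff_gap_sq w)) (fun z w => by rw [gap_comm]) hD hDc ht
  have e1 : ∀ s, ∫ p : HS d × HS d, ψ (gap (p.1 : Cd d) p.2 ^ 2)
        ∂((μ s : Measure (HS d)).prod (μ s : Measure (HS d))) =
      ∫ w : HS d, ∫ z : HS d, ψ (gap (z : Cd d) w ^ 2) ∂(μ s : Measure (HS d))
        ∂(μ s : Measure (HS d)) := fun s =>
    integral_prod_symm _ (integrable_of_continuous _
      (hψc.comp (continuous_gap_sphere.pow 2)))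
  have e2 := integral_prod_symm _ (integrable_of_continuous
    ((μ t : Measure (HS d)).prod (μ t : Measure (HS d)))
    ((hψ'.comp (continuous_gap_sphere.pow 2)).mul
      (continuous_gapSqRate (κ₀ := κ₀) (κ₁ := κ₁) (Ω := Ω) (mean (μ t : Measure (HS d))))))
  simp only [e1]
  convert h using 1
  refine e2.trans ?_
  refine integral_congr_ae (ae_of_all _ fun w => integral_congr_ae (ae_of_all _ fun z => ?_))
  change ψ' (gap (z : Cd d) w ^ 2) * (_ + _) = _
  simp only
  rw [gap_comm (w : Cd d) z, mul_add]

theorem IsMeasureValuedSolution.continuousOn_integral_gap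
    (hμ : IsMeasureValuedSolution κ₀ κ₁ Ω μ₀ μ) {ψ : ℝ → ℝ} (hψ : Continuous ψ) :
    ContinuousOn (fun s => ∫ p : HS d × HS d, ψ (gap (p.1 : Cd d) p.2 ^ 2)
        ∂((μ s : Measure (HS d)).prod (μ s : Measure (HS d)))) (Ici 0) := by
  have e1 : ∀ s, ∫ p : HS d × HS d, ψ (gap (p.1 : Cd d) p.2 ^ 2)
        ∂((μ s : Measure (HS d)).prod (μ s : Measure (HS d))) =
      ∫ w : HS d, ∫ z : HS d, ψ (gap (z : Cd d) w ^ 2) ∂(μ s : Measure (HS d))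
        ∂(μ s : Measure (HS d)) := fun s =>
    integral_prod_symm _ (integrable_of_continuous _ (hψ.comp (continuous_gap_sphere.pow 2)))
  simp only [e1]
  exact hμ.continuousOn_integral_integral (φ := fun z w => ψ (gap z w ^ 2))
    (hψ.comp ((continuous_gap continuous_fst continuous_snd).pow 2))

/-- The excess of `|1 - ⟨z, w⟩|²` over the level `a²`. -/
noncomputable def excess (a : ℝ) (z w : HS d) : ℝ := max (gap (z : Cd d) w ^ 2 - a ^ 2) 0

theorem excess_nonneg (a : ℝ) (z w : HS d) : 0 ≤ excess a z w := le_max_right _ _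

theorem continuous_excess (a : ℝ) : Continuous fun p : HS d × HS d => excess a p.1 p.2 :=
  ((continuous_gap_sphere.pow 2).sub continuous_const).max continuous_const

theorem excess_eq_zero_of_gap_le {a : ℝ} {z w : HS d} (h : gap (z : Cd d) w ≤ a) :
    excess a z w = 0 := by
  refine max_eq_right ?_
  have := gap_nonneg (z : Cd d) w
  nlinarith

/-- Linearization at level `a`, valid for every pair: `(g - a) a ≤ g² - a²` for `g ≥ a`. -/
theorem gap_le_add_excess {a : ℝ} (ha : 0 < a) (z w : HS d) :
    gap (z : Cd d) w ≤ a + excess a z w / a := by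
  rcases le_total (gap (z : Cd d) w) a with h | h
  · linarith [div_nonneg (excess_nonneg a z w) ha.le]
  · have h1 : gap (z : Cd d) w ^ 2 - a ^ 2 ≤ excess a z w := le_max_left _ _
    rw [← sub_le_iff_le_add', le_div_iff₀ ha]
    nlinarith

theorem meanGap_le_add {a : ℝ} (ha : 0 < a) (π : Measure (HS d)) [IsProbabilityMeasure π]
    (z : HS d) : meanGap π (z : Cd d) ≤ a + (∫ y, excess a y z ∂π) / a := by
  have i1 := integrable_of_continuous π (continuous_section (continuous_excess a) z)
  have hc : Continuous fun y : HS d => gap (y : Cd d) (z : Cd d) :=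
    continuous_gap (by fun_prop) (by fun_prop)
  have h : meanGap π (z : Cd d) ≤ ∫ y, (a + excess a y z / a) ∂π :=
    integral_mono (integrable_of_continuous _ hc)
      ((integrable_const _).add (i1.div_const a)) fun y => gap_le_add_excess ha y z
  rwa [integral_add (integrable_const _) (i1.div_const a), integral_div, integral_const,
    probReal_univ, one_smul] at h

/-- Overlaps with the mean are replaced by average gaps to a third point. -/
theorem gapSqRate_le (hΩ : Ωᴴ = -Ω) (hκ₀ : 0 ≤ κ₀) (π : Measure (HS d)) [IsProbabilityMeasure π]
    (z w : HS d) :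
    gapSqRate κ₀ κ₁ Ω (mean π) z w ≤
      -2 * κ₀ * gap (z : Cd d) w ^ 2 * (2 - (meanGap π (z : Cd d) + meanGap π (w : Cd d))) +
        4 * |κ₁| * gap (z : Cd d) w * (meanGap π (z : Cd d) + meanGap π (w : Cd d)) := by
  refine (gapSqDeriv_add_le hΩ (mean π) z w).trans ?_
  have h1 := one_sub_meanGap_le_re π (z : Cd d)
  have h2 := one_sub_meanGap_le_re π (w : Cd d)
  have h3 := abs_im_le_meanGap π (z : Cd d)
  have h4 := abs_im_le_meanGap π (w : Cd d)
  have h5 : 0 ≤ 4 * |κ₁| * gap (z : Cd d) w := by have := gap_nonneg (z : Cd d) w; positivity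
  have h6 : 0 ≤ 2 * κ₀ * gap (z : Cd d) w ^ 2 := by positivity
  refine add_le_add ?_ (mul_le_mul_of_nonneg_left (add_le_add h3 h4) h5)
  have := mul_le_mul_of_nonneg_left (show 2 - (meanGap π (z : Cd d) + meanGap π (w : Cd d)) ≤
    (inner ℂ (mean π) (z : Cd d)).re + (inner ℂ (mean π) (w : Cd d)).re by linarith) h6
  linarith

/-- At a pair whose gap exceeds `a` the gap can only grow because of third points whose gap to the
pair also exceeds `a`. This is where the smallness `a ≤ 1 - 2|κ₁|/κ₀` enters. -/
theorem excess_mul_gapSqRate_le (hΩ : Ωᴴ = -Ω) (hκ₀ : 0 ≤ κ₀) {a : ℝ} (ha : 0 < a)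
    (hκ : 2 * |κ₁| ≤ κ₀ * (1 - a)) (π : Measure (HS d)) [IsProbabilityMeasure π] (z w : HS d) :
    excess a z w * gapSqRate κ₀ κ₁ Ω (mean π) z w ≤
      (8 * κ₀ + 8 * |κ₁|) / a *
        (excess a z w * (∫ y, excess a y z ∂π + ∫ y, excess a y w ∂π)) := by
  have hp0 : ∀ x, 0 ≤ ∫ y, excess a y x ∂π := fun x => integral_nonneg fun y => excess_nonneg a y x
  rcases le_total (gap (z : Cd d) w) a with hga | hga
  · simp [excess_eq_zero_of_gap_le hga]
  have key : gapSqRate κ₀ κ₁ Ω (mean π) z w ≤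
      (8 * κ₀ + 8 * |κ₁|) / a * (∫ y, excess a y z ∂π + ∫ y, excess a y w ∂π) := by
    refine (gapSqRate_le hΩ hκ₀ π z w).trans ?_
    have h1 := meanGap_le_add ha π z
    have h2 := meanGap_le_add ha π w
    set g := gap (z : Cd d) w
    set S := ∫ y, excess a y z ∂π + ∫ y, excess a y w ∂π with hS
    set A := meanGap π (z : Cd d) + meanGap π (w : Cd d)
    have hS0 : 0 ≤ S / a := div_nonneg (add_nonneg (hp0 z) (hp0 w)) ha.le
    have hA : A ≤ 2 * a + S / a := by rw [hS, add_div]; linarith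
    have hg0 : 0 ≤ g := gap_nonneg _ _
    have hg2 : g ≤ 2 := gap_le_two z w
    have hk1 := abs_nonneg κ₁
    have hgg : g ^ 2 ≤ 4 := by nlinarith
    calc -2 * κ₀ * g ^ 2 * (2 - A) + 4 * |κ₁| * g * A
        = -4 * κ₀ * g ^ 2 + (2 * κ₀ * g ^ 2 + 4 * |κ₁| * g) * A := by ring
      _ ≤ -4 * κ₀ * g ^ 2 + (2 * κ₀ * g ^ 2 + 4 * |κ₁| * g) * (2 * a + S / a) := by gcongr
      _ = -4 * (κ₀ * (1 - a)) * g ^ 2 + 8 * |κ₁| * (g * a) +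
          (2 * κ₀ * g ^ 2 + 4 * |κ₁| * g) * (S / a) := by ring
      -- `a ≤ g` absorbs the phase coupling into the attraction.
      _ ≤ -4 * (2 * |κ₁|) * g ^ 2 + 8 * |κ₁| * (g * g) +
          (2 * κ₀ * 4 + 4 * |κ₁| * 2) * (S / a) := by
        have e1 := mul_le_mul_of_nonneg_right hκ (sq_nonneg g)
        have e2 : 8 * |κ₁| * (g * a) ≤ 8 * |κ₁| * (g * g) := by gcongr
        have e3 : (2 * κ₀ * g ^ 2 + 4 * |κ₁| * g) * (S / a) ≤
          (2 * κ₀ * 4 + 4 * |κ₁| * 2) * (S / a) := by gcongr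
        linarith
      _ = (8 * κ₀ + 8 * |κ₁|) / a * S := by ring
  calc _ ≤ excess a z w * ((8 * κ₀ + 8 * |κ₁|) / a *
        (∫ y, excess a y z ∂π + ∫ y, excess a y w ∂π)) :=
        mul_le_mul_of_nonneg_left key (excess_nonneg a z w)
    _ = _ := by ring

theorem integral_excess_mul_gapSqRate_le (hΩ : Ωᴴ = -Ω) (hκ₀ : 0 ≤ κ₀) {a : ℝ} (ha : 0 < a)
    (hκ : 2 * |κ₁| ≤ κ₀ * (1 - a)) (π : Measure (HS d)) [IsProbabilityMeasure π] :
    ∫ p : HS d × HS d, excess a p.1 p.2 * gapSqRate κ₀ κ₁ Ω (mean π) p.1 p.2 ∂(π.prod π) ≤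
      (8 * κ₀ + 8 * |κ₁|) / a * (2 * ∫ p : HS d × HS d, excess a p.1 p.2 ^ 2 ∂(π.prod π)) := by
  have hex := continuous_excess (d := d) a
  have hav := continuous_average (π := π) hex
  have c1 : Continuous fun p : HS d × HS d =>
      excess a p.1 p.2 * gapSqRate κ₀ κ₁ Ω (mean π) p.1 p.2 := hex.mul (continuous_gapSqRate _)
  have c2 : Continuous fun p : HS d × HS d =>
      ∫ y, excess a y p.1 ∂π + ∫ y, excess a y p.2 ∂π :=
    (hav.comp continuous_fst).add (hav.comp continuous_snd)
  have c3 : Continuous fun p : HS d × HS d =>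
      excess a p.1 p.2 * (∫ y, excess a y p.1 ∂π + ∫ y, excess a y p.2 ∂π) := hex.mul c2
  have h1 : ∫ p : HS d × HS d, excess a p.1 p.2 * gapSqRate κ₀ κ₁ Ω (mean π) p.1 p.2
      ∂(π.prod π) ≤ ∫ p : HS d × HS d, (8 * κ₀ + 8 * |κ₁|) / a *
        (excess a p.1 p.2 * (∫ y, excess a y p.1 ∂π + ∫ y, excess a y p.2 ∂π)) ∂(π.prod π) :=
    integral_mono (integrable_of_continuous _ c1) ((integrable_of_continuous _ c3).const_mul _)
      fun p => excess_mul_gapSqRate_le hΩ hκ₀ ha hκ π p.1 p.2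
  rw [integral_const_mul] at h1
  exact h1.trans (mul_le_mul_of_nonneg_left (integral_prod_mul_average_le (π := π) hex)
    (by positivity))

/-- The bound `|1 - ⟨z, w⟩| ≤ a` on the support propagates in time. -/
theorem IsMeasureValuedSolution.integral_excess_eq_zero (hΩ : Ωᴴ = -Ω)
    (hμ : IsMeasureValuedSolution κ₀ κ₁ Ω μ₀ μ) (hκ₀ : 0 ≤ κ₀) {a : ℝ} (ha : 0 < a)
    (hκ : 2 * |κ₁| ≤ κ₀ * (1 - a))
    (h0 : ∀ᵐ p : HS d × HS d ∂((μ₀ : Measure (HS d)).prod (μ₀ : Measure (HS d))),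
      gap (p.1 : Cd d) p.2 ≤ a) {t : ℝ} (ht : 0 ≤ t) :
    ∫ p : HS d × HS d, excess a p.1 p.2 ∂((μ t : Measure (HS d)).prod (μ t : Measure (HS d)))
      = 0 := by
  have hψ : ∀ x : ℝ, HasDerivAt (fun x => max (x - a ^ 2) 0 ^ 2) (2 * max (x - a ^ 2) 0) x :=
    fun x => (hasDerivAt_max_zero_sq (x - a ^ 2)).comp_sub_const x (a ^ 2)
  have hψ' : Continuous fun x : ℝ => 2 * max (x - a ^ 2) 0 := by fun_prop
  have hψc : Continuous fun x : ℝ => max (x - a ^ 2) 0 ^ 2 := by fun_prop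
  let E : ℝ → ℝ := fun s => ∫ p : HS d × HS d, excess a p.1 p.2 ^ 2
      ∂((μ s : Measure (HS d)).prod (μ s : Measure (HS d)))
  let E' : ℝ → ℝ := fun s => 2 * ∫ p : HS d × HS d,
      excess a p.1 p.2 * gapSqRate κ₀ κ₁ Ω (mean (μ s : Measure (HS d))) p.1 p.2
      ∂((μ s : Measure (HS d)).prod (μ s : Measure (HS d)))
  have hE : ContinuousOn E (Ici 0) := by
    simpa only [excess, E] using hμ.continuousOn_integral_gap hψc
  have hE' : ∀ s, 0 < s → HasDerivAt E (E' s) s := by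
    intro s hs
    have h := hμ.hasDerivAt_integral_gap hΩ hψ hψ' hs
    simp only [mul_assoc, integral_const_mul] at h
    simpa only [excess, E, E'] using h
  have hle : ∀ s, 0 < s → E' s ≤ (2 * ((8 * κ₀ + 8 * |κ₁|) / a * 2)) * E s := by
    intro s _
    have h := integral_excess_mul_gapSqRate_le (κ₁ := κ₁) hΩ hκ₀ ha hκ (μ s : Measure (HS d))
    simp only [E, E']
    linarith
  have hE0 : E 0 = 0 := by
    simp only [E, hμ.initial]
    refine integral_eq_zero_of_ae ?_
    filter_upwards [h0] with p hp
    simp [excess_eq_zero_of_gap_le hp]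
  have hsq : E t ≤ 0 := by
    have := le_mul_exp_of_hasDerivAt_le hE hE' hle ht
    rwa [hE0, zero_mul] at this
  have c2 : Continuous fun p : HS d × HS d => excess a p.1 p.2 ^ 2 := (continuous_excess a).pow 2
  have h2 : (0 : HS d × HS d → ℝ) ≤ fun p => excess a p.1 p.2 ^ 2 := fun p => sq_nonneg _
  have hae := (integral_eq_zero_iff_of_nonneg h2 (integrable_of_continuous
    ((μ t : Measure (HS d)).prod (μ t : Measure (HS d))) c2)).1
    (le_antisymm hsq (integral_nonneg h2))
  refine integral_eq_zero_of_ae ?_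
  filter_upwards [hae] with p hp
  exact (pow_eq_zero_iff two_ne_zero).1 hp

theorem integral_gap_le_of_integral_excess_eq_zero {a : ℝ} (ha : 0 < a) (π : Measure (HS d))
    [IsProbabilityMeasure π]
    (h : ∫ p : HS d × HS d, excess a p.1 p.2 ∂(π.prod π) = 0) :
    ∫ p : HS d × HS d, gap (p.1 : Cd d) p.2 ∂(π.prod π) ≤ a := by
  have i1 := integrable_of_continuous (π.prod π) (continuous_excess (d := d) a)
  have h1 : ∫ p : HS d × HS d, gap (p.1 : Cd d) p.2 ∂(π.prod π) ≤
      ∫ p : HS d × HS d, (a + excess a p.1 p.2 / a) ∂(π.prod π) :=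
    integral_mono (integrable_of_continuous _ continuous_gap_sphere)
      ((integrable_const _).add (i1.div_const a)) fun p => gap_le_add_excess ha p.1 p.2
  rw [integral_add (integrable_const _) (i1.div_const a), integral_div, h] at h1
  simpa using h1

/-- Once all gaps are at most `a`, the mean square gap decays exponentially. -/
theorem IsMeasureValuedSolution.integral_gap_sq_le (hΩ : Ωᴴ = -Ω)
    (hμ : IsMeasureValuedSolution κ₀ κ₁ Ω μ₀ μ) (hκ₀ : 0 ≤ κ₀) {a : ℝ} (ha : 0 < a)
    (hex : ∀ s, 0 ≤ s → ∫ p : HS d × HS d, excess a p.1 p.2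
      ∂((μ s : Measure (HS d)).prod (μ s : Measure (HS d))) = 0) {t : ℝ} (ht : 0 ≤ t) :
    ∫ p : HS d × HS d, gap (p.1 : Cd d) p.2 ^ 2
        ∂((μ t : Measure (HS d)).prod (μ t : Measure (HS d))) ≤
      4 * Real.exp (-(4 * (κ₀ * (1 - a) - 2 * |κ₁|)) * t) := by
  have hgr := le_mul_exp_of_hasDerivAt_le (k := -(4 * (κ₀ * (1 - a) - 2 * |κ₁|)))
    (hμ.continuousOn_integral_gap continuous_id)
    (fun s hs => hμ.hasDerivAt_integral_gap hΩ (fun x => hasDerivAt_id x) continuous_const hs)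
    (fun s hs => ?_) ht
  · refine hgr.trans (mul_le_mul_of_nonneg_right ?_ (Real.exp_nonneg _))
    have : ∫ p : HS d × HS d, gap (p.1 : Cd d) p.2 ^ 2
        ∂((μ 0 : Measure (HS d)).prod (μ 0 : Measure (HS d))) ≤
        ∫ p : HS d × HS d, (4 : ℝ) ∂((μ 0 : Measure (HS d)).prod (μ 0 : Measure (HS d))) :=
      integral_mono (integrable_of_continuous _ (continuous_gap_sphere.pow 2))
        (integrable_const _) fun p => by
          have h1 := gap_le_two p.1 p.2
          have h2 := gap_nonneg (p.1 : Cd d) p.2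
          change gap (p.1 : Cd d) p.2 ^ 2 ≤ 4
          nlinarith
    simpa using this
  · have he := hex s hs.le
    set π : Measure (HS d) := (μ s : Measure (HS d))
    have hG := continuous_gap_sphere (d := d)
    have hE := continuous_excess (d := d) a
    have hGav := continuous_average (π := π) (q := fun y z : HS d => gap (y : Cd d) z) hG
    have hEav := continuous_average (π := π) hE
    have hG2 : Continuous fun p : HS d × HS d => gap (p.1 : Cd d) p.2 ^ 2 := hG.pow 2
    have i1 := integrable_of_continuous (π.prod π) hG2
    have c2 : Continuous fun p : HS d × HS d =>
        ∫ y, excess a y p.1 ∂π + ∫ y, excess a y p.2 ∂π :=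
      (hEav.comp continuous_fst).add (hEav.comp continuous_snd)
    have c3 : Continuous fun p : HS d × HS d => gap (p.1 : Cd d) p.2 *
        (∫ y : HS d, gap (y : Cd d) p.1 ∂π + ∫ y : HS d, gap (y : Cd d) p.2 ∂π) :=
      hG.mul ((hGav.comp continuous_fst).add (hGav.comp continuous_snd))
    have h1 : ∫ p : HS d × HS d, 1 * gapSqRate κ₀ κ₁ Ω (mean π) p.1 p.2 ∂(π.prod π) ≤
        ∫ p : HS d × HS d, (-4 * (κ₀ * (1 - a)) * gap (p.1 : Cd d) p.2 ^ 2 +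
          (8 * κ₀ / a * (∫ y, excess a y p.1 ∂π + ∫ y, excess a y p.2 ∂π) +
          4 * |κ₁| * (gap (p.1 : Cd d) p.2 *
            (∫ y : HS d, gap (y : Cd d) p.1 ∂π + ∫ y : HS d, gap (y : Cd d) p.2 ∂π))))
          ∂(π.prod π) := by
      refine integral_mono (integrable_of_continuous _
          (continuous_const.mul (continuous_gapSqRate _)))
        ((i1.const_mul _).add (((integrable_of_continuous _ c2).const_mul _).add
          ((integrable_of_continuous _ c3).const_mul _))) fun p => ?_
      have b1 := meanGap_le_add ha π p.1
      have b2 := meanGap_le_add ha π p.2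
      have b3 := gapSqRate_le (κ₁ := κ₁) hΩ hκ₀ π p.1 p.2
      simp only [one_mul]
      refine b3.trans ?_
      change _ ≤ -4 * (κ₀ * (1 - a)) * gap (p.1 : Cd d) p.2 ^ 2 +
          (8 * κ₀ / a * (∫ y, excess a y p.1 ∂π + ∫ y, excess a y p.2 ∂π) +
          4 * |κ₁| * (gap (p.1 : Cd d) p.2 * (meanGap π (p.1 : Cd d) + meanGap π (p.2 : Cd d))))
      have hg0 := gap_nonneg (p.1 : Cd d) p.2
      have hg2 := gap_le_two p.1 p.2
      set g := gap (p.1 : Cd d) p.2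
      set S := ∫ y, excess a y p.1 ∂π + ∫ y, excess a y p.2 ∂π with hS
      set A := meanGap π (p.1 : Cd d) + meanGap π (p.2 : Cd d)
      have hS0 : 0 ≤ S / a := div_nonneg (add_nonneg
        (integral_nonneg fun y => excess_nonneg a y p.1)
        (integral_nonneg fun y => excess_nonneg a y p.2)) ha.le
      have hA : A ≤ 2 * a + S / a := by rw [hS, add_div]; linarith
      have hgg : g ^ 2 ≤ 4 := by nlinarith
      have e1 : 2 * κ₀ * g ^ 2 * A ≤ 2 * κ₀ * g ^ 2 * (2 * a + S / a) := by gcongr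
      have e2 : 2 * κ₀ * g ^ 2 * (S / a) ≤ 2 * κ₀ * 4 * (S / a) := by gcongr
      have e3 : 8 * κ₀ / a * S = 2 * κ₀ * 4 * (S / a) := by ring
      rw [e3]
      linarith
    have i2 := (integrable_of_continuous (π.prod π) c2).const_mul (8 * κ₀ / a)
    have i3 := (integrable_of_continuous (π.prod π) c3).const_mul (4 * |κ₁|)
    rw [integral_add (i1.const_mul _) (i2.fun_add i3), integral_add i2 i3] at h1
    simp only [integral_const_mul, integral_prod_average_add hE, he] at h1 ⊢
    have h2 := mul_le_mul_of_nonneg_left (integral_prod_mul_average_le (π := π)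
      (q := fun y z : HS d => gap (y : Cd d) z) hG) (show 0 ≤ 4 * |κ₁| by positivity)
    change _ ≤ _ * ∫ p : HS d × HS d, gap (p.1 : Cd d) p.2 ^ 2 ∂(π.prod π)
    linarith

end Evolution

/-! ### Convergence of the norm of the mean -/

section Evolution

variable {d : ℕ} {κ₀ κ₁ : ℝ} {Ω : Matrix (Fin d) (Fin d) ℂ} {μ₀ : ProbabilityMeasure (HS d)}
  {μ : ℝ → ProbabilityMeasure (HS d)}

/-- The set of gaps is bounded by `2`, so that its supremum in `ℝ` is a true supremum. -/
theorem ae_gap_le_of_sSup_le (π : Measure (HS d)) [IsProbabilityMeasure π] {a : ℝ}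
    (h : sSup (image2 (fun z w : HS d => ‖1 - inner ℂ (z : Cd d) (w : Cd d)‖)
      π.support π.support) ≤ a) :
    ∀ᵐ p : HS d × HS d ∂(π.prod π), gap (p.1 : Cd d) p.2 ≤ a := by
  have hs : ∀ᵐ z ∂π, z ∈ π.support := Measure.support_mem_ae
  filter_upwards [Measure.quasiMeasurePreserving_fst.ae hs,
    Measure.quasiMeasurePreserving_snd.ae hs] with p hp1 hp2
  refine (le_csSup ⟨2, ?_⟩ (mem_image2_of_mem hp1 hp2)).trans h
  rintro _ ⟨z, _, w, _, rfl⟩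
  exact gap_le_two z w

/-- A bound on the mean square gap gives one on the mean gap, through `g ≤ ε + g² / ε`. -/
theorem integral_gap_le_of_sq_le (π : Measure (HS d)) [IsProbabilityMeasure π] {ε C : ℝ}
    (hε : 0 < ε) (h : ∫ p : HS d × HS d, gap (p.1 : Cd d) p.2 ^ 2 ∂(π.prod π) ≤ C * ε ^ 2) :
    ∫ p : HS d × HS d, gap (p.1 : Cd d) p.2 ∂(π.prod π) ≤ (1 + C) * ε := by
  have c2 : Continuous fun p : HS d × HS d => gap (p.1 : Cd d) p.2 ^ 2 :=
    continuous_gap_sphere.pow 2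
  have i2 := (integrable_of_continuous (π.prod π) c2).div_const ε
  have h1 : ∫ p : HS d × HS d, gap (p.1 : Cd d) p.2 ∂(π.prod π) ≤
      ∫ p : HS d × HS d, (ε + gap (p.1 : Cd d) p.2 ^ 2 / ε) ∂(π.prod π) := by
    refine integral_mono (integrable_of_continuous _ continuous_gap_sphere)
      ((integrable_const _).add i2) fun p => ?_
    have h0 := gap_nonneg (p.1 : Cd d) p.2
    change gap (p.1 : Cd d) p.2 ≤ ε + gap (p.1 : Cd d) p.2 ^ 2 / ε
    rw [← sub_le_iff_le_add', le_div_iff₀ hε]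
    nlinarith [sq_nonneg (gap (p.1 : Cd d) p.2 - ε)]
  rw [integral_add (integrable_const _) i2, integral_div, integral_const, probReal_univ,
    one_smul] at h1
  have h2 : (∫ p : HS d × HS d, gap (p.1 : Cd d) p.2 ^ 2 ∂(π.prod π)) / ε ≤ C * ε := by
    rw [div_le_iff₀ hε]
    linarith
  linarith

/-- The mean never vanishes, and its norm tends to `1`. -/
theorem IsMeasureValuedSolution.norm_mean (hΩ : Ωᴴ = -Ω)
    (hμ : IsMeasureValuedSolution κ₀ κ₁ Ω μ₀ μ) (hκ₀ : 0 ≤ κ₀) {a : ℝ} (ha : 0 < a) (ha1 : a < 1)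
    (hκ : 2 * |κ₁| < κ₀ * (1 - a))
    (h0 : ∀ᵐ p : HS d × HS d ∂((μ₀ : Measure (HS d)).prod (μ₀ : Measure (HS d))),
      gap (p.1 : Cd d) p.2 ≤ a) :
    (∀ t, 0 ≤ t → mean (μ t : Measure (HS d)) ≠ 0) ∧
      Tendsto (fun t => ‖mean (μ t : Measure (HS d))‖) atTop (𝓝 1) := by
  have hex : ∀ s, 0 ≤ s → ∫ p : HS d × HS d, excess a p.1 p.2
      ∂((μ s : Measure (HS d)).prod (μ s : Measure (HS d))) = 0 := fun s hs =>
    hμ.integral_excess_eq_zero hΩ hκ₀ ha hκ.le h0 hs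
  constructor
  · intro t ht h
    have h1 := integral_gap_le_of_integral_excess_eq_zero ha _ (hex t ht)
    have h2 := abs_one_sub_norm_mean_sq_le (π := (μ t : Measure (HS d)))
    rw [h] at h2
    norm_num at h2
    linarith
  · set c := κ₀ * (1 - a) - 2 * |κ₁|
    have hc : 0 < c := sub_pos.2 hκ
    have hsq : Tendsto (fun t => ‖mean (μ t : Measure (HS d))‖ ^ 2) atTop (𝓝 1) := by
      have hexp : Tendsto (fun t : ℝ => (1 + 4) * Real.exp (-(2 * c * t))) atTop (𝓝 0) := by
        have : Tendsto (fun t : ℝ => 2 * c * t) atTop atTop :=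
          tendsto_id.const_mul_atTop (by positivity)
        simpa using (Real.tendsto_exp_neg_atTop_nhds_zero.comp this).const_mul (1 + 4)
      rw [tendsto_iff_norm_sub_tendsto_zero]
      refine squeeze_zero' (.of_forall fun t => norm_nonneg _) ?_ hexp
      filter_upwards [eventually_ge_atTop 0] with t ht
      rw [Real.norm_eq_abs, abs_sub_comm]
      refine abs_one_sub_norm_mean_sq_le.trans (integral_gap_le_of_sq_le _ (Real.exp_pos _) ?_)
      refine (hμ.integral_gap_sq_le hΩ hκ₀ ha hex ht).trans (le_of_eq ?_)
      rw [← Real.exp_nat_mul]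
      congr 2
      push_cast
      ring
    have := hsq.sqrt
    simpa [Real.sqrt_sq (norm_nonneg _)] using this

end Evolution

/-! ### Wasserstein estimates on the sphere -/

section Wasserstein

variable {d : ℕ}

theorem edist_rpow_two (z w : HS d) :
    edist z w ^ (2 : ℝ) = ENNReal.ofReal (‖(z : Cd d) - (w : Cd d)‖ ^ 2) := by
  rw [Subtype.edist_eq, edist_dist, dist_eq_norm,
    ENNReal.ofReal_rpow_of_nonneg (norm_nonneg _) zero_le_two, Real.rpow_two]

/-- The `W₂` distance from a Dirac mass at the direction of the mean. -/
theorem wasserstein_dirac_le (π : Measure (HS d)) [IsProbabilityMeasure π] (x : HS d)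
    (hx : mean π = (‖mean π‖ : ℂ) • (x : Cd d)) :
    wasserstein 2 π (Measure.dirac x) ≤
      ENNReal.ofReal (2 - 2 * ‖mean π‖) ^ (1 / 2 : ℝ) := by
  refine ENNReal.rpow_le_rpow ?_ (by norm_num)
  have hm : Measurable fun y : HS d => (y, x) := by fun_prop
  -- The only transport plan to a Dirac mass moves every point to `x`.
  have hplan : π.map (fun y => (y, x)) ∈ transportPlans π (Measure.dirac x) := by
    constructor
    · rw [Measure.map_map measurable_fst hm]
      exact Measure.map_id
    · rw [Measure.map_map measurable_snd hm]
      change π.map (fun _ => x) = _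
      rw [Measure.map_const, measure_univ, one_smul]
  refine (iInf₂_le _ hplan).trans (le_of_eq ?_)
  have hc : Continuous fun y : HS d => ‖(y : Cd d) - (x : Cd d)‖ ^ 2 := by fun_prop
  rw [lintegral_map (by fun_prop) hm]
  simp only [edist_rpow_two]
  rw [← ofReal_integral_eq_lintegral_ofReal (integrable_of_continuous π hc)
    (ae_of_all _ fun y => sq_nonneg _)]
  congr 1
  have e : ∀ y : HS d, ‖(y : Cd d) - (x : Cd d)‖ ^ 2 =
      2 - 2 * (inner ℂ (x : Cd d) (y : Cd d)).re := by
    intro y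
    rw [@norm_sub_sq ℂ, norm_eq_of_mem_sphere, norm_eq_of_mem_sphere, ← inner_conj_symm,
      RCLike.conj_re, RCLike.re_to_complex]
    ring
  have i1 : Integrable (fun y : HS d => inner ℂ (x : Cd d) (y : Cd d)) π :=
    (integrable_coe π).const_inner _
  have i2 : Integrable (fun y : HS d => (inner ℂ (x : Cd d) (y : Cd d)).re) π := i1.re
  simp only [e]
  rw [integral_sub (integrable_const _) (i2.const_mul 2), integral_const_mul]
  have h1 : ∫ y : HS d, (inner ℂ (x : Cd d) (y : Cd d)).re ∂π =
      (inner ℂ (x : Cd d) (mean π)).re := by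
    rw [mean, ← integral_inner (integrable_coe π)]
    exact integral_re i1
  have h2 : (inner ℂ (x : Cd d) (mean π)).re = ‖mean π‖ := by
    rw [hx, inner_smul_right, inner_self_sphere, mul_one, Complex.ofReal_re, ← hx]
  rw [h1, h2]
  simp

/-- The mean is `1`-Lipschitz for `W₂`. -/
theorem ofReal_norm_mean_sub_le_wasserstein (π ρ : Measure (HS d)) [IsProbabilityMeasure π] :
    ENNReal.ofReal ‖mean π - mean ρ‖ ≤ wasserstein 2 π ρ := by
  have h : ENNReal.ofReal (‖mean π - mean ρ‖ ^ 2) ≤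
      ⨅ γ ∈ transportPlans π ρ, ∫⁻ y, edist y.1 y.2 ^ (2 : ℝ) ∂γ := by
    refine le_iInf₂ fun γ hγ => ?_
    obtain ⟨h1, h2⟩ := hγ
    have : IsProbabilityMeasure γ := by
      constructor
      rw [← preimage_univ (f := Prod.fst), ← Measure.map_apply measurable_fst .univ, h1,
        measure_univ]
    have c1 : Continuous fun y : HS d × HS d => ((y.1 : Cd d) - (y.2 : Cd d)) := by fun_prop
    have i1 : Integrable (fun y : HS d × HS d => (y.1 : Cd d)) γ :=
      Continuous.integrable_of_hasCompactSupport (by fun_prop) (HasCompactSupport.of_compactSpace _)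
    have i2 : Integrable (fun y : HS d × HS d => (y.2 : Cd d)) γ :=
      Continuous.integrable_of_hasCompactSupport (by fun_prop) (HasCompactSupport.of_compactSpace _)
    have hmean : mean π - mean ρ = ∫ y : HS d × HS d, ((y.1 : Cd d) - (y.2 : Cd d)) ∂γ := by
      rw [integral_sub i1 i2, mean, mean, ← h1, ← h2,
        integral_map measurable_fst.aemeasurable (by fun_prop),
        integral_map measurable_snd.aemeasurable (by fun_prop)]
    have hle : ‖mean π - mean ρ‖ ≤ ∫ y : HS d × HS d, ‖(y.1 : Cd d) - (y.2 : Cd d)‖ ∂γ := by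
      rw [hmean]
      exact norm_integral_le_integral_norm _
    have hsq := mul_integral_le γ c1.norm (∫ y : HS d × HS d, ‖(y.1 : Cd d) - (y.2 : Cd d)‖ ∂γ)
    have c2 : Continuous fun y : HS d × HS d => ‖(y.1 : Cd d) - (y.2 : Cd d)‖ ^ 2 := by fun_prop
    simp only [edist_rpow_two]
    rw [← ofReal_integral_eq_lintegral_ofReal (integrable_of_continuous γ c2)
      (ae_of_all _ fun y => sq_nonneg _)]
    refine ENNReal.ofReal_le_ofReal ?_
    nlinarith [norm_nonneg (mean π - mean ρ)]
  have h' := ENNReal.rpow_le_rpow h (show (0 : ℝ) ≤ 1 / 2 by norm_num)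
  refine le_trans (le_of_eq ?_) h'
  rw [ENNReal.ofReal_rpow_of_nonneg (sq_nonneg _) (by norm_num), ← Real.sqrt_eq_rpow,
    Real.sqrt_sq (norm_nonneg _)]

theorem norm_mean_bipolar {m : ℝ} (h0 : 0 ≤ m) (h1 : m ≤ 1) (w : HS d) :
    ‖mean (bipolar m w)‖ = |2 * m - 1| := by
  have e : mean (bipolar m w) = (2 * m - 1 : ℝ) • (w : Cd d) := by
    rw [mean, bipolar, integral_add_measure
      ((integrable_coe _).smul_measure ENNReal.ofReal_ne_top)
      ((integrable_coe _).smul_measure ENNReal.ofReal_ne_top), integral_smul_measure,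
      integral_smul_measure, integral_dirac, integral_dirac, ENNReal.toReal_ofReal h0,
      ENNReal.toReal_ofReal (sub_nonneg.2 h1), coe_neg_sphere]
    module
  rw [e, norm_smul, norm_eq_of_mem_sphere, mul_one, Real.norm_eq_abs]

end Wasserstein

end LHS

/-! ### Complete aggregation and the absence of bi-polar states -/

theorem mainTheorem4 (d : ℕ) (κ₀ κ₁ δ : ℝ) (Ω : Matrix (Fin d) (Fin d) ℂ) (hΩ : Ωᴴ = -Ω)
    (hκ : |κ₁| < κ₀ / 2) (hδ : 0 < δ)
    (μ₀ : ProbabilityMeasure (LHS.HS d)) (μ : ℝ → ProbabilityMeasure (LHS.HS d))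
    (hsupp : sSup (image2 (fun z w : LHS.HS d => ‖1 - inner ℂ (z : LHS.Cd d) (w : LHS.Cd d)‖)
        (μ₀ : Measure (LHS.HS d)).support (μ₀ : Measure (LHS.HS d)).support)
      < 1 - 2 * |κ₁| / κ₀ - δ)
    (hμ : LHS.IsMeasureValuedSolution κ₀ κ₁ Ω μ₀ μ) :
    (∃ z : ℝ → LHS.HS d, ContinuousOn z (Ici 0) ∧
      Tendsto (fun t => LHS.wasserstein 2 (μ t : Measure (LHS.HS d)) (Measure.dirac (z t)))
        atTop (𝓝 0)) ∧
    ∀ m : ℝ, 0 < m → m < 1 → ∀ w : ℝ → LHS.HS d,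
      ¬ Tendsto (fun t => LHS.wasserstein 2 (μ t : Measure (LHS.HS d)) (LHS.bipolar m (w t)))
        atTop (𝓝 0) := by
  have hκ₁ : 0 ≤ |κ₁| := abs_nonneg κ₁
  have hκ₀ : 0 < κ₀ := by linarith
  set a : ℝ := 1 - 2 * |κ₁| / κ₀ - δ with ha_def
  have ha : 0 < a := by
    refine lt_of_le_of_lt (Real.sSup_nonneg ?_) hsupp
    rintro _ ⟨z, _, w, _, rfl⟩
    exact norm_nonneg _
  have hquot : 0 ≤ 2 * |κ₁| / κ₀ := by positivity
  have ha1 : a < 1 := by linarith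
  have hκa : 2 * |κ₁| < κ₀ * (1 - a) := by
    have : κ₀ * (1 - a) = 2 * |κ₁| + κ₀ * δ := by rw [ha_def]; field_simp; ring
    rw [this]
    linarith [mul_pos hκ₀ hδ]
  obtain ⟨hne, hlim⟩ := hμ.norm_mean hΩ hκ₀.le ha ha1 hκa (LHS.ae_gap_le_of_sSup_le _ hsupp.le)
  constructor
  -- The curve is the direction of the mean, frozen at negative times.
  · let v : ℝ → LHS.Cd d := fun t => LHS.mean (μ (max t 0) : Measure (LHS.HS d))
    have hv : Continuous v := LHS.continuous_mean.comp hμ.continuous_max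
    have hv0 : ∀ t, ‖v t‖ ≠ 0 := fun t => norm_ne_zero_iff.2 (hne _ (le_max_right _ _))
    refine ⟨fun t => ⟨‖v t‖⁻¹ • v t, ?_⟩, ?_, ?_⟩
    · rw [mem_sphere_zero_iff_norm, norm_smul, norm_inv, norm_norm, inv_mul_cancel₀ (hv0 t)]
    · exact (((hv.norm.inv₀ hv0).smul hv).subtype_mk _).continuousOn
    · have h1 : Tendsto (fun t => ENNReal.ofReal (2 - 2 * ‖LHS.mean (μ t : Measure (LHS.HS d))‖)
          ^ (1 / 2 : ℝ)) atTop (𝓝 0) := by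
        have h2 : Tendsto (fun t => 2 - 2 * ‖LHS.mean (μ t : Measure (LHS.HS d))‖) atTop
            (𝓝 (2 - 2 * 1)) := (hlim.const_mul 2).const_sub 2
        have h3 := (ENNReal.tendsto_ofReal h2).ennrpow_const (1 / 2 : ℝ)
        simpa using h3
      refine tendsto_of_tendsto_of_tendsto_of_le_of_le' tendsto_const_nhds h1
        (.of_forall fun t => zero_le) ?_
      filter_upwards [eventually_ge_atTop 0] with t ht
      refine LHS.wasserstein_dirac_le _ _ ?_
      have hvt : v t = LHS.mean (μ t : Measure (LHS.HS d)) := by simp only [v, max_eq_left ht]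
      simp only [← hvt]
      rw [Complex.coe_smul, smul_inv_smul₀ (hv0 t)]
  · intro m hm0 hm1 w hw
    have h1 : ∀ t, ENNReal.ofReal (‖LHS.mean (μ t : Measure (LHS.HS d))‖ - |2 * m - 1|) ≤
        LHS.wasserstein 2 (μ t : Measure (LHS.HS d)) (LHS.bipolar m (w t)) := fun t => by
      refine le_trans (ENNReal.ofReal_le_ofReal ?_)
        (LHS.ofReal_norm_mean_sub_le_wasserstein _ _)
      rw [← LHS.norm_mean_bipolar hm0.le hm1.le (w t)]
      exact norm_sub_norm_le _ _
    have h2 := le_of_tendsto_of_tendsto' (ENNReal.tendsto_ofReal (hlim.sub_const |2 * m - 1|)) hw h1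
    have h3 : 1 - |2 * m - 1| ≤ 0 := ENNReal.ofReal_eq_zero.1 (le_antisymm h2 zero_le)
    have h4 : |2 * m - 1| < 1 := abs_lt.2 ⟨by linarith, by linarith⟩
    linarith
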